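/- **Setting.** Let $X$, $Y$ be finite sets of questions; all answers are bits. A function $\varepsilon:\mathbb N\to\mathbb R$ is negligible if for every $k$ there is $N$ with $\varepsilon(\lambda)\le\lambda^{-k}$ for all $\lambda\ge N$. A *QPT circuit family* is a logspace-uniform family of polynomial-size quantum circuits (gates $H$, $T$, CNOT) on polynomially many qubits, indexed by the security parameter $\lambda$. Let $\mathsf{Gen},\mathsf{Enc},\mathsf{Dec}$ be the key generation, encryption and decryption of a quantum homomorphic encryption scheme with plaintexts $x\in X$: $\mathsf{sk}\leftarrow\mathsf{Gen}(1^\lambda)$, $\chi\leftarrow\mathsf{Enc}(\mathsf{sk},x)$, and $\mathsf{Dec}(\mathsf{sk},\alpha)\in\{0,1\}$ for an encrypted answer $\alpha$, where $\mathsf{sk}$, $\chi$, $\alpha$ are bit strings whose lengths depend on $\lambda$. The only property assumed of the scheme is security against QPT distinguishers: for all $x_0,x_1\in X$ and every QPT circuit family $\mathfrak A$ with one output bit, there is a negligible $\varepsilon$ with $\big|\Pr[\mathfrak A(\mathsf{Enc}(\mathsf{sk},x_0))=1]-\Pr[\mathfrak A(\mathsf{Enc}(\mathsf{sk},x_1))=1]\big|\le\varepsilon(\lambda)$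 for all $\lambda$, the probability including $\mathsf{sk}\leftarrow\mathsf{Gen}(1^\lambda)$. A *compiled model* is a two-round prover given by QPT circuit families. On input $\chi$ it prepares and measures its qubits, outputs $\alpha$ (whose length is computable in logspace from $1^\lambda$), and then applies a further circuit, which results in the sub-normalized state $|\Psi_{\alpha|\chi}\rangle$ with squared norm the probability of $\alpha$. On input $y\in Y$ it then performs a measurement $\{N_{b|y}\}_{b\in\{0,1\}}$, implemented by a circuit with ancillas; we assume that the $N_{b|y}$ are projections, and set $B_y=N_{0|y}-N_{1|y}$. For $f:\{0,1\}\to\mathbb C$ and an operator $T$ on the qubits of the prover let $$\mathcal E_x[f,T]=\mathop{\mathbb E}_{\mathsf{sk}\leftarrow\mathsf{Gen}(1^\lambda)}\ \mathop{\mathbb E}_{\chi\leftarrow\mathsf{Enc}(\mathsf{sk},x)}\ \sum_\alpha f(\mathsf{Dec}(\mathsf{sk},\alpha))\,\langle\Psi_{\alpha|\chi}|T|\Psi_{\alpha|\chi}\rangle ,$$ so that the correlation of the model is $p(a,b|x,y)=\mathcal E_x[\delta_{a,\cdot},N_{b|y}]$. Fix a probability distribution $\mu$ on $X$. In the free $*$-algebra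 generated by self-adjoint letters $A_x$ $(x\in X)$, $B_y$ $(y\in Y)$, consider the monomials in which at most one of the letters $A_x$ occurs. Under $[A_x,B_y]=0$, $A_x^2=B_y^2=1$, each has a canonical form $A_x^i\,\bar w(B)$ with $i\in\{0,1\}$ and $\bar w$ reduced. The *extended pseudo-expectation* $\tilde{\mathbb E}=\tilde{\mathbb E}^{(\lambda)}$ is the linear functional on the span of these monomials whose value on a monomial is $$\sum_{x'\in X}\mu(x')\,\mathcal E_{x'}[1,\bar w(B)]\ \text{ if } i=0,\qquad \mathcal E_x[(-1)^{(\cdot)},\bar w(B)]\ \text{ if } i=1 .$$ **Theorem.** Let the scheme be secure against QPT distinguishers, and let a compiled model with projective second-round measurements and a distribution $\mu$ on $X$ be given. 1. Let $x\in X$ and let $P=\sum_{i=1}^m\gamma_i\,(A_x)^{k_i}\,w_i(B)$ with $\gamma_i\in\mathbb C$, $k_i\in\{0,1\}$ and arbitrary monomials $w_i$ in the $B_y$, $y\in Y$. Then there is a negligible function $\mathrm{negl}$ such that, for all $\lambda$, $\tilde{\mathbb E}[P^\dagger P]$ is real and $$\tilde{\mathbb E}[P^\dagger P]\ \ge\ -\mathrm{negl}(\lambda).$$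 2. Let $I=\sum_{a,b,x,y}w_{abxy}\,p(a,b|x,y)$ with $w_{abxy}\in\mathbb R$ be a Bell functional, and let $S=\sum_{a,b,x,y} w_{abxy}\,\tfrac{1+(-1)^aA_x}{2}\,\tfrac{1+(-1)^bB_y}{2}$ be its Bell polynomial. Then $\tilde{\mathbb E}[S]$ is the value of $I$ on the compiled model up to a negligible function: there is a negligible $\mathrm{negl}$ with $|\tilde{\mathbb E}[S]-I|\le\mathrm{negl}(\lambda)$ for all $\lambda$. 3. If, moreover, there are $\beta_y\in\mathbb R$ with $\sum_{a,b}(-1)^b w_{abxy}=\mu(x)\beta_y$ for all $x,y$ (that is, if the marginal terms $\langle B_y\rangle$ of $I$, if any, are averaged over $x$ with respect to $\mu$), then $\tilde{\mathbb E}[S]=I$ exactly, for all $\lambda$. -/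

import Mathlib

open scoped Matrix

noncomputable section

/-! ### Quantum circuits over the Clifford+T gate set -/

/-- Bit strings of length `n`. -/
abbrev Bits (n : ℕ) : Type := Fin n → Bool

/-- The gates: Hadamard, the `T` gate `diag(1, e^{iπ/4})`, and the controlled NOT
`cnot control target`. The arguments are wire numbers. -/
inductive Gate : Type
  | had (i : ℕ)
  | tee (i : ℕ)
  | cnot (i j : ℕ)

/-- Relabelling of the wires of a gate. -/
def Gate.map (f : ℕ → ℕ) : Gate → Gate
  | .had i => .had (f i)
  | .tee i => .tee (f i)
  | .cnot i j => .cnot (f i) (f j)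

/-- The gate is a legal gate on the wires `0, …, q - 1`. -/
def Gate.WellFormed (q : ℕ) : Gate → Prop
  | .had i => i < q
  | .tee i => i < q
  | .cnot i j => i < q ∧ j < q ∧ i ≠ j

/-- The content of wire `i` of a computational basis state of `q` qubits. -/
def wire {q : ℕ} (s : Bits q) (i : ℕ) : Bool := if h : i < q then s ⟨i, h⟩ else false

/-- The unitary matrix of a gate on `q` qubits, in the computational basis.
Ill-formed gates, which never occur in the circuit families below, act as the identity. -/
def Gate.matrix (q : ℕ) : Gate → Matrix (Bits q) (Bits q) ℂ
  | .had i =>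
      if i < q then
        Matrix.of fun s t =>
          if ∀ j : Fin q, (j : ℕ) ≠ i → s j = t j then
            (if wire s i && wire t i then -1 else 1) / (Real.sqrt 2 : ℂ)
          else 0
      else 1
  | .tee i =>
      Matrix.diagonal fun s =>
        if wire s i then Complex.exp (Complex.I * (Real.pi : ℂ) / 4) else 1
  | .cnot i j =>
      if i = j then 1
      else
        Matrix.of fun s t =>
          if s = (fun l : Fin q => if (l : ℕ) = j then xor (t l) (wire t i) else t l) then 1 else 0

/-- The unitary matrix of a circuit on `q` qubits; the head of the list is applied first. -/
def circuitMatrix (q : ℕ) : List Gate → Matrix (Bits q) (Bits q) ℂ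
  | [] => 1
  | g :: C => circuitMatrix q C * g.matrix q

/-- The basis vector of `q` qubits holding `χ` on the wires `off, …, off + c - 1` and `0` on all
other wires. -/
def inputVec (q off : ℕ) {c : ℕ} (χ : Bits c) : Bits q → ℂ :=
  Pi.single
    (fun i => if h : off ≤ (i : ℕ) ∧ (i : ℕ) - off < c then χ ⟨(i : ℕ) - off, h.2⟩ else false) 1

/-- The projection onto the basis states with the content `α` on the wires `0, …, l - 1`. -/
def registerProj (q : ℕ) {l : ℕ} (α : Bits l) : Matrix (Bits q) (Bits q) ℂ :=
  Matrix.diagonal fun s => if ∀ j : Fin l, wire s j = α j then 1 else 0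

/-- The projection onto the basis states with the content `b` on wire `0`. -/
def bitProj (q : ℕ) (b : Bool) : Matrix (Bits q) (Bits q) ℂ :=
  Matrix.diagonal fun s => if wire s 0 = b then 1 else 0

/-! ### Logarithmic-space uniformity

The machine model is a register machine with a write-only output, run on programs with a
fixed finite set of registers. A run is in logarithmic space if all numbers that are ever stored
are bounded by a polynomial in the input `n` (given in unary as `1^n`), so that each register
occupies `O(log n)` bits; a halting run then takes polynomial time as well. -/

/-- Arithmetic expressions in the registers; `sub` is truncated subtraction. -/
inductive RegExpr : Type
  | const (c : ℕ)
  | reg (r : ℕ)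
  | add (e f : RegExpr)
  | sub (e f : RegExpr)
  | mul (e f : RegExpr)

def RegExpr.value (s : ℕ → ℕ) : RegExpr → ℕ
  | .const c => c
  | .reg r => s r
  | .add e f => e.value s + f.value s
  | .sub e f => e.value s - f.value s
  | .mul e f => e.value s * f.value s

/-- Programs. `emit g` writes the gate `g` to the output, where the numbers in `g` name the
registers that contain the wires; `ifz r p p'` runs `p` if register `r` is zero and `p'`
otherwise; `loop r p` repeats `p` as long as register `r` is nonzero. -/
inductive Program : Type
  | skip
  | assign (r : ℕ) (e : RegExpr)
  | emit (g : Gate)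
  | seq (p p' : Program)
  | ifz (r : ℕ) (p p' : Program)
  | loop (r : ℕ) (p : Program)

/-- `Exec m p s C t`: started in the register contents `s`, the program `p` halts with the
register contents `t`, has written the list `C`, and has never stored a number greater
than `m`. -/
inductive Exec (m : ℕ) : Program → (ℕ → ℕ) → List Gate → (ℕ → ℕ) → Prop
  | skip (s : ℕ → ℕ) : Exec m .skip s [] s
  | assign (s : ℕ → ℕ) (r : ℕ) (e : RegExpr) (h : e.value s ≤ m) :
      Exec m (.assign r e) s [] (Function.update s r (e.value s))
  | emit (s : ℕ → ℕ) (g : Gate) : Exec m (.emit g) s [g.map s] s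
  | seq {p p' : Program} {s t u : ℕ → ℕ} {C D : List Gate} :
      Exec m p s C t → Exec m p' t D u → Exec m (.seq p p') s (C ++ D) u
  | ifzZero {r : ℕ} {p p' : Program} {s t : ℕ → ℕ} {C : List Gate} :
      s r = 0 → Exec m p s C t → Exec m (.ifz r p p') s C t
  | ifzPos {r : ℕ} {p p' : Program} {s t : ℕ → ℕ} {C : List Gate} :
      s r ≠ 0 → Exec m p' s C t → Exec m (.ifz r p p') s C t
  | loopDone {r : ℕ} {p : Program} {s : ℕ → ℕ} : s r = 0 → Exec m (.loop r p) s [] s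
  | loopStep {r : ℕ} {p : Program} {s t u : ℕ → ℕ} {C D : List Gate} :
      s r ≠ 0 → Exec m p s C t → Exec m (.loop r p) t D u → Exec m (.loop r p) s (C ++ D) u

/-- The initial register contents: the input in register `0`, all others zero. -/
def inputRegs (n : ℕ) : ℕ → ℕ := fun r => if r = 0 then n else 0

/-- A function is bounded by a polynomial. -/
def PolyBounded (f : ℕ → ℕ) : Prop := ∃ p : Polynomial ℕ, ∀ n, f n ≤ p.eval n

/-- `f` is computable in logarithmic space from `1^n`, with the value in register `0`. -/
def LogspaceComputable (f : ℕ → ℕ) : Prop :=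
  ∃ (prog : Program) (p : Polynomial ℕ), ∀ n, ∃ t : ℕ → ℕ,
    Exec (p.eval n) prog (inputRegs n) [] t ∧ t 0 = f n

/-- A family of circuits is logspace-uniform and of polynomial size. -/
def UniformFamily (C : ℕ → List Gate) : Prop :=
  ∃ (prog : Program) (p : Polynomial ℕ), ∀ n, (C n).length ≤ p.eval n ∧
    ∃ t : ℕ → ℕ, Exec (p.eval n) prog (inputRegs n) (C n) t

/-- A quantum polynomial time (QPT) circuit family; the `n`-th circuit acts on `q n` qubits, where
`n` is the security parameter. -/
structure QPTCircuits (q : ℕ → ℕ) where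
  gates : ℕ → List Gate
  width_poly : PolyBounded q
  wellFormed : ∀ n, ∀ g ∈ gates n, g.WellFormed (q n)
  uniform : UniformFamily gates

/-- The unitary matrix of the `n`-th circuit. -/
def QPTCircuits.matrix {q : ℕ → ℕ} (C : QPTCircuits q) (n : ℕ) :
    Matrix (Bits (q n)) (Bits (q n)) ℂ :=
  circuitMatrix (q n) (C.gates n)

/-! ### Encryption -/

/-- A function `ε : ℕ → ℝ` is negligible. -/
def Negligible (ε : ℕ → ℝ) : Prop :=
  ∀ k : ℕ, ∃ N : ℕ, ∀ n ≥ N, ε n ≤ 1 / (n : ℝ) ^ k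

/-- The key generation, encryption and (classical) decryption of a quantum homomorphic encryption
scheme, with the questions `x : X` as plaintexts and one-bit answers. For the security
parameter `n`, keys, encrypted questions and encrypted answers are bit strings of the lengths
`keyLen n`, `ctLen n`, `outLen n`. No bound on the running time of the three is imposed. -/
structure EncScheme (X : Type) where
  keyLen : ℕ → ℕ
  ctLen : ℕ → ℕ
  outLen : ℕ → ℕ
  gen : ∀ n, PMF (Bits (keyLen n))
  enc : ∀ n, Bits (keyLen n) → X → PMF (Bits (ctLen n))
  dec : ∀ n, Bits (keyLen n) → Bits (outLen n) → Bool

namespace EncScheme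

variable {X : Type}

/-- The probability that the distinguisher `D` outputs `1` on an encryption of `x` under a fresh
key. The ciphertext is on the wires `1, …, ctLen n`, the other wires are `0` initially, and
the output is the measured value of wire `0`. -/
def acceptProb (S : EncScheme X) {q : ℕ → ℕ} (D : QPTCircuits q) (n : ℕ) (x : X) : ℝ :=
  ∑ sk : Bits (S.keyLen n), (S.gen n sk).toReal *
    ∑ χ : Bits (S.ctLen n), (S.enc n sk x χ).toReal *
      ∑ s : Bits (q n), if wire s 0 = true then
        ‖(D.matrix n *ᵥ inputVec (q n) 1 χ) s‖ ^ 2 else 0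

/-- Security against QPT distinguishers: encryptions of any two plaintexts are indistinguishable
up to a negligible function. -/
def Secure (S : EncScheme X) : Prop :=
  ∀ (x₀ x₁ : X) (q : ℕ → ℕ) (D : QPTCircuits q), (∀ n, S.ctLen n + 1 ≤ q n) →
    ∃ ε : ℕ → ℝ, Negligible ε ∧ ∀ n, |S.acceptProb D n x₀ - S.acceptProb D n x₁| ≤ ε n

end EncScheme

/-! ### Compiled models -/

/-- A compiled quantum model for questions `x : X`, `y : Y` and one-bit answers: an efficient
prover for the two-round protocol. The device has `q n` qubits.
* First round: the ciphertext `χ` is placed on the wires `0, …, ctLen n - 1`, the other wires are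
  `0`; the circuit `first` is run (it includes the preparation of the initial state), the
  wires `0, …, outLen n - 1` are measured and give the encrypted answer `α`, and the
  circuit `post` is applied to the post-measurement state; this state still holds `α`, and whatever
  record of `χ` the circuit `first` keeps, so that the unitary applied may depend on both.
* Second round: on question `y`, `anc n` further qubits in state `0` are appended, the circuit
  `second y` is run, and wire `0` is measured and gives the answer `b`. -/
structure CompiledModel {X : Type} (S : EncScheme X) (Y : Type) where
  /-- The number of qubits of the device. -/
  q : ℕ → ℕ
  /-- The number of ancillas of the second round. -/
  anc : ℕ → ℕ
  ctLen_le : ∀ n, S.ctLen n ≤ q n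
  outLen_le : ∀ n, S.outLen n ≤ q n
  /-- The measured register of the first round is uniformly generated, like the circuits. -/
  outLen_uniform : LogspaceComputable S.outLen
  first : QPTCircuits q
  post : QPTCircuits q
  second : Y → QPTCircuits (fun n => q n + anc n)

/-- The letters of the noncommutative polynomials: Alice's observables `A_x` and Bob's
observables `B_y`. -/
inductive Obs (X Y : Type) : Type
  | alice (x : X)
  | bob (y : Y)

/-- Noncommutative complex polynomials in the observables. -/
abbrev ObsPoly (X Y : Type) : Type := MonoidAlgebra ℂ (FreeMonoid (Obs X Y))

/-- The sign `(-1)^a`. -/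
def sgn (a : Bool) : ℂ := if a then -1 else 1

namespace ObsPoly

variable {X Y : Type}

/-- The observable `A_x`. -/
def A (x : X) : ObsPoly X Y := MonoidAlgebra.single (FreeMonoid.of (Obs.alice x)) 1

/-- The observable `B_y`. -/
def B (y : Y) : ObsPoly X Y := MonoidAlgebra.single (FreeMonoid.of (Obs.bob y)) 1

/-- The monomial `B_{y₁} B_{y₂} ⋯` given by a list of questions. -/
def bobMonomial (w : List Y) : ObsPoly X Y := (w.map B).prod

/-- The adjoint: antilinear, reverses words, and fixes the observables. -/
def dagger (P : ObsPoly X Y) : ObsPoly X Y :=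
  P.coeff.sum fun w c => MonoidAlgebra.single (star w) (star c)

/-- The measurement operator `M_{a|x} = (1 + (-1)^a A_x) / 2`. -/
def measA (a : Bool) (x : X) : ObsPoly X Y := (1 / 2 : ℂ) • (1 + sgn a • A x)

/-- The measurement operator `N_{b|y} = (1 + (-1)^b B_y) / 2`. -/
def measB (b : Bool) (y : Y) : ObsPoly X Y := (1 / 2 : ℂ) • (1 + sgn b • B y)

/-- The Bell operator `∑ w_{abxy} M_{a|x} N_{b|y}`. -/
def bellOperator [Fintype X] [Fintype Y] (w : Bool → Bool → X → Y → ℝ) : ObsPoly X Y :=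
  ∑ a, ∑ b, ∑ x, ∑ y, (w a b x y : ℂ) • (measA a x * measB b y)

end ObsPoly

/-- The settings `x` of the letters `A_x` of a word, in order. -/
def aliceLetters {X Y : Type} (w : FreeMonoid (Obs X Y)) : List X :=
  w.toList.filterMap fun l => match l with
    | .alice x => some x
    | .bob _ => none

/-- The settings `y` of the letters `B_y` of a word, in order. -/
def bobLetters {X Y : Type} (w : FreeMonoid (Obs X Y)) : List Y :=
  w.toList.filterMap fun l => match l with
    | .alice _ => none
    | .bob y => some y

/-- The reduced form of a monomial in Bob's observables under the relations `(B_y)² = 1`. -/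
def bobReduce {Y : Type} [DecidableEq Y] (w : List Y) : List Y :=
  w.foldr (fun y r => if r.head? = some y then r.tail else y :: r) []

namespace CompiledModel

variable {X Y : Type} {S : EncScheme X}

/-- The sub-normalized post-measurement state `|Ψ_{α|χ}⟩` of the first round. -/
def state (M : CompiledModel S Y) (n : ℕ) (χ : Bits (S.ctLen n)) (α : Bits (S.outLen n)) :
    Bits (M.q n) → ℂ :=
  M.post.matrix n *ᵥ (registerProj (M.q n) α *ᵥ (M.first.matrix n *ᵥ inputVec (M.q n) 0 χ))

/-- The POVM element `N_{b|y}` of the second round: the compression of `V† (|b⟩⟨b| ⊗ 1) V` to the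
subspace in which the ancillas are zero, where `V` is the circuit for `y`. -/
def povm (M : CompiledModel S Y) (n : ℕ) (y : Y) (b : Bool) :
    Matrix (Bits (M.q n)) (Bits (M.q n)) ℂ :=
  (((M.second y).matrix n)ᴴ * bitProj (M.q n + M.anc n) b * (M.second y).matrix n).submatrix
    (fun s => Fin.append s fun _ => false) (fun s => Fin.append s fun _ => false)

/-- All measurements of the second round are projective. -/
def IsProjective (M : CompiledModel S Y) : Prop := ∀ n y b, IsStarProjection (M.povm n y b)

/-- Bob's observable `B_y = N_{0|y} - N_{1|y}` of the model. -/
def bobObs (M : CompiledModel S Y) (n : ℕ) (y : Y) : Matrix (Bits (M.q n)) (Bits (M.q n)) ℂ :=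
  M.povm n y false - M.povm n y true

/-- The value of a monomial in Bob's observables. -/
def bobOp (M : CompiledModel S Y) (n : ℕ) (w : List Y) : Matrix (Bits (M.q n)) (Bits (M.q n)) ℂ :=
  (w.map (M.bobObs n)).prod

/-- `𝔼_{sk ← Gen(1^n)} 𝔼_{χ ← Enc(sk, x)} ∑_α f(Dec(sk, α)) ⟨Ψ_{α|χ}| T |Ψ_{α|χ}⟩`. -/
def expect (M : CompiledModel S Y) (n : ℕ) (x : X) (f : Bool → ℂ)
    (T : Matrix (Bits (M.q n)) (Bits (M.q n)) ℂ) : ℂ :=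
  ∑ sk : Bits (S.keyLen n), ((S.gen n sk).toReal : ℂ) *
    ∑ χ : Bits (S.ctLen n), ((S.enc n sk x χ).toReal : ℂ) *
      ∑ α : Bits (S.outLen n), f (S.dec n sk α) * (star (M.state n χ α) ⬝ᵥ (T *ᵥ M.state n χ α))

/-- The correlation `p(a, b | x, y)` of the model. -/
def prob (M : CompiledModel S Y) (n : ℕ) (a b : Bool) (x : X) (y : Y) : ℝ :=
  (M.expect n x (fun a' => if a' = a then 1 else 0) (M.povm n y b)).re

/-- The value `∑ w_{abxy} p(a, b | x, y)` of a Bell functional on the model. -/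
def bellValue [Fintype X] [Fintype Y] (M : CompiledModel S Y) (n : ℕ)
    (w : Bool → Bool → X → Y → ℝ) : ℝ :=
  ∑ a, ∑ b, ∑ x, ∑ y, w a b x y * M.prob n a b x y

/-- The extended pseudo-expectation of a monomial in `A_x` and the `B_y`, for a single `x`. Under
`[A_x, B_y] = 0`, `(A_x)² = (B_y)² = 1` its canonical form is `(A_x)^i w̄(B)` with `i` the parity of
the number of letters `A_x`. The case `i = 0` is averaged over `x` with respect to `μ`.
Monomials with two different letters `A_x`, `A_{x'}` are outside the domain of the
pseudo-expectation, and `0` is assigned to them only to have a total function. -/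
def pseudoExpMonomial [Fintype X] [DecidableEq X] [DecidableEq Y] (M : CompiledModel S Y)
    (μ : PMF X) (n : ℕ) (w : FreeMonoid (Obs X Y)) : ℂ :=
  let T := M.bobOp n (bobReduce (bobLetters w))
  let even : ℂ := ∑ x, ((μ x).toReal : ℂ) * M.expect n x (fun _ => 1) T
  match aliceLetters w with
  | [] => even
  | x :: xs =>
      if ∀ x' ∈ xs, x' = x then
        if Even (x :: xs).length then even else M.expect n x sgn T
      else 0

/-- The extended pseudo-expectation: the linear extension from the monomials. -/
def pseudoExp [Fintype X] [DecidableEq X] [DecidableEq Y] (M : CompiledModel S Y)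
    (μ : PMF X) (n : ℕ) : ObsPoly X Y →ₗ[ℂ] ℂ :=
  Finsupp.linearCombination ℂ (M.pseudoExpMonomial μ n) ∘ₗ
    (MonoidAlgebra.coeffLinearEquiv ℂ).toLinearMap

end CompiledModel

end

/-! Fix `x`. If the `μ`-average in the even part of the pseudo-expectation is replaced by the single
term for `x`, the value on `P†P` becomes an average of the squared norms of `(∑ γ_i s^{k_i} w_i(B))
Ψ_{α|χ}`, where `s = ±1` is the sign of the decrypted answer, and so it is nonnegative
(`re_square_nonneg`). The odd part is the same in both expressions. The error is therefore a
combination, with coefficients independent of the security parameter, of differences between the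
expectations of a word `w(B)` under encryptions of two questions. No decryption enters these
differences, so they are negligible as soon as they can be observed by a QPT circuit
(`expect_bobOp_indistinguishable`). For Bell polynomials, the constant, the `A_x` and the `A_x B_y`
terms agree exactly with the correlation; only the marginals of Bob differ, through averaging over
the question (`pseudoExp_bellOperator_sub`). If their coefficients are `μ(x) β_y`, the differences
sum to zero.

The main work is the observing circuit. Since the measurements are projective, `B_y` squares to one
and `w(B)` is unitary, so a Hadamard test reads off its expectation: without a phase on the control
it yields the real part, and with two `T` gates, that is the phase `i`, the imaginary part. With
only `H`, `T` and CNOT available, the following devices are needed.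

The measurement of the encrypted answer is deferred: the answer register is copied by CNOTs to
untouched wires (`slice_first_round`). The controlled `B_y` is `V† · controlled-Z · V`, where only
the middle gate is controlled. Projectivity implies that `V† Z V` returns the ancillas to zero
(`mulVec_padVec`), so that all letters of a word may share them. Finally, the test has to be
logspace-uniform: `Exec.transform` simulates a given generator while altering its output on the fly,
and `UniformFamily.restartable_invCircuit` generates `V†` by rerunning the generator of `V` for each
position, from the last to the first. -/

noncomputable section

/-! ### Transformations of programs -/

/-- A number exceeding all registers read by an expression. -/
def RegExpr.bound : RegExpr → ℕ
  | .const _ => 0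
  | .reg r => r + 1
  | .add e f => max e.bound f.bound
  | .sub e f => max e.bound f.bound
  | .mul e f => max e.bound f.bound

/-- Renaming of the registers `r ↦ r + K`. -/
def RegExpr.shift (K : ℕ) : RegExpr → RegExpr
  | .const c => .const c
  | .reg r => .reg (r + K)
  | .add e f => .add (e.shift K) (f.shift K)
  | .sub e f => .sub (e.shift K) (f.shift K)
  | .mul e f => .mul (e.shift K) (f.shift K)

/-- A number exceeding all wires of a gate. -/
def Gate.bound : Gate → ℕ
  | .had i => i + 1
  | .tee i => i + 1
  | .cnot i j => max (i + 1) (j + 1)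

/-- A number exceeding all registers used by a program. -/
def Program.bound : Program → ℕ
  | .skip => 0
  | .assign r e => max (r + 1) e.bound
  | .emit g => g.bound
  | .seq p p' => max p.bound p'.bound
  | .ifz r p p' => max (r + 1) (max p.bound p'.bound)
  | .loop r p => max (r + 1) p.bound

/-- The program with its registers renamed by `r ↦ r + K` and the emission of a gate `g` replaced
by the program `f g`. -/
def Program.transform (K : ℕ) (f : Gate → Program) : Program → Program
  | .skip => .skip
  | .assign r e => .assign (r + K) (e.shift K)
  | .emit g => f (g.map (· + K))
  | .seq p p' => .seq (p.transform K f) (p'.transform K f)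
  | .ifz r p p' => .ifz (r + K) (p.transform K f) (p'.transform K f)
  | .loop r p => .loop (r + K) (p.transform K f)

theorem RegExpr.value_shift {K R : ℕ} {s s' : ℕ → ℕ} (h : ∀ r < R, s' (r + K) = s r)
    (e : RegExpr) (he : e.bound ≤ R) : (e.shift K).value s' = e.value s := by
  induction e with
  | const c => rfl
  | reg r => exact h r he
  | add e f ihe ihf | sub e f ihe ihf | mul e f ihe ihf =>
    simp only [RegExpr.bound, max_le_iff] at he
    simp only [RegExpr.shift, RegExpr.value, ihe he.1, ihf he.2]

theorem Gate.map_map (f g : ℕ → ℕ) (a : Gate) : (a.map f).map g = a.map (fun i => g (f i)) := by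
  cases a <;> rfl

theorem Gate.map_congr {f g : ℕ → ℕ} {R : ℕ} (h : ∀ r < R, f r = g r) (a : Gate)
    (ha : a.bound ≤ R) : a.map f = a.map g := by
  cases a with
  | had i | tee i => simp only [Gate.map, h i ha]
  | cnot i j =>
    simp only [Gate.bound, max_le_iff] at ha
    simp only [Gate.map, h i ha.1, h j ha.2]

theorem Exec.mono {m m' : ℕ} (hm : m ≤ m') {p : Program} {s t : ℕ → ℕ} {C : List Gate}
    (h : Exec m p s C t) : Exec m' p s C t := by
  induction h with
  | skip s => exact .skip s
  | assign s r e h => exact .assign s r e (h.trans hm)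
  | emit s g => exact .emit s g
  | seq _ _ ih ih' => exact .seq ih ih'
  | ifzZero h _ ih => exact .ifzZero h ih
  | ifzPos h _ ih => exact .ifzPos h ih
  | loopDone h => exact .loopDone h
  | loopStep h _ _ ih ih' => exact .loopStep h ih ih'

/-! ### Simulating a generator while rewriting its output -/

/-- The output of a transducer with a counter on a list of gates. -/
def transduce (out : ℕ → Gate → List Gate) (next : ℕ → Gate → ℕ) : ℕ → List Gate → List Gate
  | _, [] => []
  | c, g :: C => out c g ++ transduce out next (next c g) C

theorem transduce_append (out : ℕ → Gate → List Gate) (next : ℕ → Gate → ℕ) (c : ℕ)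
    (C D : List Gate) :
    transduce out next c (C ++ D) =
      transduce out next c C ++ transduce out next (C.foldl next c) D := by
  induction C generalizing c with
  | nil => rfl
  | cons g C ih => simp [transduce, ih]

theorem foldl_le {next : ℕ → Gate → ℕ} (h : ∀ c g, next c g ≤ c) (C : List Gate) (c : ℕ) :
    C.foldl next c ≤ c := by
  induction C generalizing c with
  | nil => exact le_rfl
  | cons g C ih => exact (ih _).trans (h c g)

/-- A transformed program runs in parallel with the original one. Registers below `K` are
available to the replacements `f g`; register `0` and register `2` are kept and register `1` is
the counter of the transducer. -/
theorem Exec.transform {m m' K R B : ℕ} (hm : m ≤ m') (hK : 2 < K) (f : Gate → Program)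
    (out : ℕ → Gate → List Gate) (next : ℕ → Gate → ℕ) (Good : Gate → Prop)
    (hB : ∀ c g, next c g ≤ c)
    (hf : ∀ (g : Gate) (s : ℕ → ℕ), s 1 ≤ B → Good ((g.map (· + K)).map s) →
      ∃ t, Exec m' (f (g.map (· + K))) s (out (s 1) ((g.map (· + K)).map s)) t ∧
        (∀ r ≥ K, t r = s r) ∧ t 0 = s 0 ∧ t 1 = next (s 1) ((g.map (· + K)).map s) ∧ t 2 = s 2)
    {p : Program} {s t : ℕ → ℕ} {C : List Gate} (h : Exec m p s C t) (hp : p.bound ≤ R)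
    (hC : ∀ g ∈ C, Good g) (s' : ℕ → ℕ) (hs : ∀ r < R, s' (r + K) = s r)
    (hs1 : s' 1 ≤ B) : ∃ t', Exec m' (p.transform K f) s' (transduce out next (s' 1) C) t' ∧
      (∀ r < R, t' (r + K) = t r) ∧ t' 0 = s' 0 ∧ t' 1 = C.foldl next (s' 1) ∧ t' 2 = s' 2 := by
  induction h generalizing s' with
  | skip s => exact ⟨s', .skip _, hs, rfl, rfl, rfl⟩
  | assign s r e h =>
    simp only [Program.bound, max_le_iff] at hp
    have hv := RegExpr.value_shift hs e hp.2
    refine ⟨_, .assign _ _ _ (by rw [hv]; exact h.trans hm), fun k hk => ?_, ?_, ?_, ?_⟩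
    · rw [hv]
      by_cases hkr : k = r
      · subst hkr; simp
      · rw [Function.update_of_ne (by omega), Function.update_of_ne hkr, hs k hk]
    all_goals rw [Function.update_of_ne (by omega)]; try rfl
  | emit s g =>
    have hg : (g.map (· + K)).map s' = g.map s := by
      rw [Gate.map_map]; exact Gate.map_congr hs g hp
    obtain ⟨t', h1, h2, h3, h4, h5⟩ := hf g s' hs1 (by rw [hg]; exact hC _ (by simp))
    rw [hg] at h1 h4
    refine ⟨t', ?_, fun r hr => ?_, h3, h4, h5⟩
    · simpa [transduce, Program.transform] using h1
    · rw [h2 _ (by omega), hs r hr]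
  | seq _ _ ih ih' =>
    simp only [Program.bound, max_le_iff] at hp
    simp only [List.mem_append] at hC
    obtain ⟨u, a1, a2, a3, a4, a5⟩ := ih hp.1 (fun g hg => hC g (.inl hg)) s' hs hs1
    -- The counter never grows (`hB`), so the bound `B` that `hf` needs still holds when the second
    -- program starts.
    obtain ⟨v, b1, b2, b3, b4, b5⟩ := ih' hp.2 (fun g hg => hC g (.inr hg)) u a2
      (a4 ▸ (foldl_le hB _ _).trans hs1)
    refine ⟨v, ?_, b2, b3.trans a3, by rw [b4, a4, List.foldl_append], b5.trans a5⟩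
    rw [transduce_append, ← a4]
    exact .seq a1 b1
  | ifzZero h _ ih =>
    simp only [Program.bound, max_le_iff] at hp
    obtain ⟨u, a1, a⟩ := ih hp.2.1 hC s' hs hs1
    exact ⟨u, .ifzZero (by rw [hs _ hp.1, h]) a1, a⟩
  | ifzPos h _ ih =>
    simp only [Program.bound, max_le_iff] at hp
    obtain ⟨u, a1, a⟩ := ih hp.2.2 hC s' hs hs1
    exact ⟨u, .ifzPos (by rw [hs _ hp.1]; exact h) a1, a⟩
  | loopDone h =>
    simp only [Program.bound, max_le_iff] at hp
    exact ⟨s', .loopDone (by rw [hs _ hp.1, h]), hs, rfl, rfl, rfl⟩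
  | loopStep h _ _ ih ih' =>
    have hp' := hp
    simp only [Program.bound, max_le_iff] at hp
    simp only [List.mem_append] at hC
    obtain ⟨u, a1, a2, a3, a4, a5⟩ := ih hp.2 (fun g hg => hC g (.inl hg)) s' hs hs1
    obtain ⟨v, b1, b2, b3, b4, b5⟩ := ih' hp' (fun g hg => hC g (.inr hg)) u a2
      (a4 ▸ (foldl_le hB _ _).trans hs1)
    refine ⟨v, ?_, b2, b3.trans a3, by rw [b4, a4, List.foldl_append], b5.trans a5⟩
    rw [transduce_append, ← a4]
    exact .loopStep (by rw [hs _ hp.1]; exact h) a1 b1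

/-- Set the registers `K, …, K + R - 1` to zero. -/
def clearRegs (K : ℕ) : ℕ → Program
  | 0 => .skip
  | R + 1 => .seq (clearRegs K R) (.assign (R + K) (.const 0))

theorem exec_clearRegs (m K R : ℕ) (s : ℕ → ℕ) :
    ∃ t, Exec m (clearRegs K R) s [] t ∧ (∀ r < R, t (r + K) = 0) ∧ ∀ r < K, t r = s r := by
  induction R with
  | zero => exact ⟨s, .skip s, by simp, by simp⟩
  | succ R ih =>
    obtain ⟨t, h1, h2, h3⟩ := ih
    refine ⟨Function.update t (R + K) 0,
      .seq (C := []) (D := []) h1 (.assign t (R + K) (.const 0) (Nat.zero_le _)),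
      fun r hr => ?_, fun r hr => ?_⟩
    · by_cases h : r = R
      · subst h; simp
      · rw [Function.update_of_ne (by omega), h2 r (by omega)]
    · rw [Function.update_of_ne (by omega), h3 r hr]

/-- Run a transformed program from the initial register contents, with the input copied from
register `0`. -/
def Program.restart (K : ℕ) (f : Gate → Program) (p : Program) : Program :=
  .seq (clearRegs K (p.bound + 1)) (.seq (.assign K (.reg 0)) (p.transform K f))

/-- Generators are run one after another, so each has to cope with the contents left behind by its
predecessor. The original register `0`, which holds the input at the start and a computed value at
the end, is now register `K`. -/
theorem Exec.restart {m m' K n B : ℕ} (hm : m ≤ m') (hn : n ≤ m') (hK : 2 < K) (f : Gate → Program)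
    (out : ℕ → Gate → List Gate) (next : ℕ → Gate → ℕ) (Good : Gate → Prop)
    (hB : ∀ c g, next c g ≤ c)
    (hf : ∀ (g : Gate) (s : ℕ → ℕ), s 1 ≤ B → Good ((g.map (· + K)).map s) →
      ∃ t, Exec m' (f (g.map (· + K))) s (out (s 1) ((g.map (· + K)).map s)) t ∧
        (∀ r ≥ K, t r = s r) ∧ t 0 = s 0 ∧ t 1 = next (s 1) ((g.map (· + K)).map s) ∧ t 2 = s 2)
    {p : Program} {t : ℕ → ℕ} {C : List Gate} (h : Exec m p (inputRegs n) C t)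
    (hC : ∀ g ∈ C, Good g) (s' : ℕ → ℕ) (hs : s' 0 = n)
    (hs1 : s' 1 ≤ B) : ∃ t', Exec m' (p.restart K f) s' (transduce out next (s' 1) C) t' ∧
      t' K = t 0 ∧ t' 0 = n ∧ t' 2 = s' 2 := by
  obtain ⟨u, a1, a2, a3⟩ := exec_clearRegs m' K (p.bound + 1) s'
  have hu0 : u 0 = n := by rw [a3 0 (by omega), hs]
  have a4 := Exec.assign (m := m') u K (.reg 0) (by simpa [RegExpr.value, hu0] using hn)
  -- Tracking `bound + 1` registers ensures that register `0` is among them even if the program uses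
  -- none.
  obtain ⟨v, b1, b2, b3, b4, b5⟩ := Exec.transform (R := p.bound + 1) hm hK f out next Good hB hf h
    (Nat.le_succ _) hC (Function.update u K (u 0)) (fun r hr => by
      by_cases h : r = 0
      · subst h; simp [inputRegs, hu0]
      · rw [Function.update_of_ne (by omega), a2 r hr]; simp [inputRegs, h])
    (by rwa [Function.update_of_ne (by omega), a3 1 (by omega)])
  rw [Function.update_of_ne (by omega), a3 1 (by omega)] at b1
  rw [Function.update_of_ne (by omega), hu0] at b3
  rw [Function.update_of_ne (by omega), a3 2 (by omega)] at b5
  refine ⟨v, ?_, by simpa using b2 0 (by omega), b3, b5⟩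
  exact .seq (C := []) a1 (.seq (C := []) a4 b1)

/-! ### Closure properties of uniform families -/

/-- A polynomial is the value of an arithmetic expression in the register `0`. -/
theorem exists_regExpr (p : Polynomial ℕ) : ∃ e : RegExpr, ∀ s, e.value s = p.eval (s 0) := by
  induction p using Polynomial.induction_on' with
  | add p q hp hq =>
    obtain ⟨e, he⟩ := hp
    obtain ⟨f, hf⟩ := hq
    exact ⟨.add e f, fun s => by simp [RegExpr.value, he, hf]⟩
  | monomial k a =>
    induction k with
    | zero => exact ⟨.const a, fun s => by simp [RegExpr.value]⟩
    | succ k ih =>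
      obtain ⟨e, he⟩ := ih
      refine ⟨.mul e (.reg 0), fun s => ?_⟩
      simp only [RegExpr.value, he, Polynomial.eval_monomial]
      ring

/-- Families of circuits that are generated in logarithmic space by a program that may be started
with any contents of the registers other than `0`, and that keeps the input in register `0`. -/
def RestartableFamily (C : ℕ → List Gate) : Prop :=
  ∃ (prog : Program) (p : Polynomial ℕ), ∀ (n : ℕ) (s : ℕ → ℕ), s 0 = n →
    (C n).length ≤ p.eval n ∧ ∃ t : ℕ → ℕ, Exec (p.eval n) prog s (C n) t ∧ t 0 = n

theorem RestartableFamily.uniform {C : ℕ → List Gate} (h : RestartableFamily C) :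
    UniformFamily C := by
  obtain ⟨prog, p, h⟩ := h
  refine ⟨prog, p, fun n => ?_⟩
  obtain ⟨h1, t, h2, -⟩ := h n (inputRegs n) rfl
  exact ⟨h1, t, h2⟩

theorem RestartableFamily.append {C D : ℕ → List Gate} (hC : RestartableFamily C)
    (hD : RestartableFamily D) : RestartableFamily (fun n => C n ++ D n) := by
  obtain ⟨p, P, hp⟩ := hC
  obtain ⟨q, Q, hq⟩ := hD
  refine ⟨.seq p q, P + Q, fun n s hs => ?_⟩
  obtain ⟨a, t, b, c⟩ := hp n s hs
  obtain ⟨a', t', b', c'⟩ := hq n t c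
  rw [Polynomial.eval_add, List.length_append]
  exact ⟨by omega, t', .seq (b.mono (by omega)) (b'.mono (by omega)), c'⟩

theorem RestartableFamily.nil : RestartableFamily (fun _ => []) :=
  ⟨.skip, 0, fun _ s hs => ⟨by simp, s, .skip s, hs⟩⟩

theorem RestartableFamily.gate (g : Gate) : RestartableFamily (fun _ => [g]) := by
  cases g with
  | had i =>
    refine ⟨.seq (.assign 1 (.const i)) (.emit (.had 1)), Polynomial.C (i + 1), fun n s hs => ?_⟩
    rw [Polynomial.eval_C]
    have h := Exec.emit (m := i + 1) (Function.update s 1 i) (.had 1)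
    simp only [Gate.map, Function.update_self] at h
    exact ⟨by simp, _, .seq (C := []) (.assign s 1 (.const i) (by simp [RegExpr.value])) h,
      by simpa using hs⟩
  | tee i =>
    refine ⟨.seq (.assign 1 (.const i)) (.emit (.tee 1)), Polynomial.C (i + 1), fun n s hs => ?_⟩
    rw [Polynomial.eval_C]
    have h := Exec.emit (m := i + 1) (Function.update s 1 i) (.tee 1)
    simp only [Gate.map, Function.update_self] at h
    exact ⟨by simp, _, .seq (C := []) (.assign s 1 (.const i) (by simp [RegExpr.value])) h,
      by simpa using hs⟩
  | cnot i j =>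
    refine ⟨.seq (.assign 1 (.const i)) (.seq (.assign 2 (.const j)) (.emit (.cnot 1 2))),
      Polynomial.C (i + j + 1), fun n s hs => ?_⟩
    rw [Polynomial.eval_C]
    have h := Exec.emit (m := i + j + 1) (Function.update (Function.update s 1 i) 2 j) (.cnot 1 2)
    simp only [Gate.map, Function.update_self] at h
    rw [Function.update_of_ne (by omega), Function.update_self] at h
    exact ⟨by simp, _,
      .seq (C := []) (.assign s 1 (.const i) (by simp only [RegExpr.value]; omega))
        (.seq (C := []) (.assign _ 2 (.const j) (by simp only [RegExpr.value]; omega)) h),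
      by simpa using hs⟩

theorem RestartableFamily.const (C : List Gate) : RestartableFamily (fun _ => C) := by
  induction C with
  | nil => exact RestartableFamily.nil
  | cons g C ih => exact (RestartableFamily.gate g).append ih

/-- Emission of a gate on the wires that follow the given ones. -/
def emitSucc : Gate → Program
  | .had i => .seq (.assign 3 (.add (.reg i) (.const 1))) (.emit (.had 3))
  | .tee i => .seq (.assign 3 (.add (.reg i) (.const 1))) (.emit (.tee 3))
  | .cnot i j => .seq (.assign 3 (.add (.reg i) (.const 1)))
      (.seq (.assign 4 (.add (.reg j) (.const 1))) (.emit (.cnot 3 4)))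

/-- Well-formedness is what keeps the incremented wire numbers within the space bound. The shift is
`5` because registers `0` to `4` hold the input, the counter, a loop variable and two wire numbers.
-/
theorem exec_emitSucc {m q : ℕ} (hm : q ≤ m) (g : Gate) (s : ℕ → ℕ)
    (hg : ((g.map (· + 5)).map s).WellFormed q) :
    ∃ t, Exec m (emitSucc (g.map (· + 5))) s [((g.map (· + 5)).map s).map (· + 1)] t ∧
      (∀ r ≥ 5, t r = s r) ∧ t 0 = s 0 ∧ t 1 = s 1 ∧ t 2 = s 2 := by
  cases g with
  | had i =>
    have hi : s (i + 5) < q := hg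
    have h := Exec.emit (m := m) (Function.update s 3 (s (i + 5) + 1)) (.had 3)
    simp only [Gate.map, Function.update_self] at h
    refine ⟨_, .seq (C := []) (.assign s 3 _ (by simp only [RegExpr.value]; omega)) h,
      fun r hr => ?_, ?_, ?_, ?_⟩ <;> rw [Function.update_of_ne (by omega)]
  | tee i =>
    have hi : s (i + 5) < q := hg
    have h := Exec.emit (m := m) (Function.update s 3 (s (i + 5) + 1)) (.tee 3)
    simp only [Gate.map, Function.update_self] at h
    refine ⟨_, .seq (C := []) (.assign s 3 _ (by simp only [RegExpr.value]; omega)) h,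
      fun r hr => ?_, ?_, ?_, ?_⟩ <;> rw [Function.update_of_ne (by omega)]
  | cnot i j =>
    obtain ⟨hi, hj, -⟩ : s (i + 5) < q ∧ s (j + 5) < q ∧ s (i + 5) ≠ s (j + 5) := hg
    have h := Exec.emit (m := m)
      (Function.update (Function.update s 3 (s (i + 5) + 1)) 4 (s (j + 5) + 1)) (.cnot 3 4)
    simp only [Gate.map, Function.update_self] at h
    rw [Function.update_of_ne (by omega), Function.update_self] at h
    have h4 := Exec.assign (m := m) (Function.update s 3 (s (i + 5) + 1)) 4
      (.add (.reg (j + 5)) (.const 1))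
      (by simp only [RegExpr.value]; rw [Function.update_of_ne (by omega)]; omega)
    simp only [RegExpr.value] at h4
    rw [Function.update_of_ne (by omega)] at h4
    refine ⟨_, .seq (C := []) (.assign s 3 _ (by simp only [RegExpr.value]; omega))
      (.seq (C := []) h4 h), fun r hr => ?_, ?_, ?_, ?_⟩ <;>
      rw [Function.update_of_ne (by omega), Function.update_of_ne (by omega)]

theorem QPTCircuits.restartable_succ {q : ℕ → ℕ} (D : QPTCircuits q) :
    RestartableFamily (fun n => (D.gates n).map (Gate.map (· + 1))) := by
  obtain ⟨prog, p, h⟩ := D.uniform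
  obtain ⟨r, hr⟩ := D.width_poly
  -- `p` pays for the simulated run, `r` for the shifted wire numbers, and `X` for the second copy
  -- of the input.
  refine ⟨prog.restart 5 emitSucc, p + r + Polynomial.X, fun n s hs => ?_⟩
  obtain ⟨hl, t, ht⟩ := h n
  have hr := hr n
  simp only [Polynomial.eval_add, Polynomial.eval_X, List.length_map]
  refine ⟨by omega, ?_⟩
  obtain ⟨t', a, -, b, -⟩ := Exec.restart (m' := p.eval n + r.eval n + n) (by omega) (by omega)
    (by omega : 2 < 5) emitSucc (fun _ g => [g.map (· + 1)]) (fun c _ => c)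
    (Gate.WellFormed (q n)) (fun _ _ => le_rfl) (fun g s _ hg => exec_emitSucc (by omega) g s hg) ht
    (D.wellFormed n) s hs le_rfl
  refine ⟨t', ?_, b⟩
  convert a using 1
  generalize D.gates n = C
  induction C with
  | nil => rfl
  | cons g C ih => simp [transduce, ih]

/-! ### Uniform generation of inverse circuits -/

/-- The inverse of a gate, as a circuit. -/
def Gate.inv : Gate → List Gate
  | .had i => [.had i]
  | .tee i => List.replicate 7 (.tee i)
  | .cnot i j => [.cnot i j]

/-- The inverse circuit. -/
def invCircuit (C : List Gate) : List Gate := C.reverse.flatMap Gate.inv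

/-- Emission of a list of gates. -/
def emitList : List Gate → Program
  | [] => .skip
  | g :: C => .seq (.emit g) (emitList C)

theorem exec_emitList (m : ℕ) (s : ℕ → ℕ) (C : List Gate) :
    Exec m (emitList C) s (C.map (Gate.map s)) s := by
  induction C with
  | nil => exact .skip s
  | cons g C ih => exact .seq (.emit s g) ih

theorem Gate.inv_map (f : ℕ → ℕ) (g : Gate) : (g.map f).inv = g.inv.map (Gate.map f) := by
  cases g <;> simp [Gate.map, Gate.inv]

/-- Emission of the inverse of the gate when the counter in register `1` steps down to zero. -/
def emitSelected (g : Gate) : Program :=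
  .ifz 1 .skip (.seq (.assign 1 (.sub (.reg 1) (.const 1))) (.ifz 1 (emitList g.inv) .skip))

theorem exec_emitSelected {m : ℕ} (g : Gate) (s : ℕ → ℕ) (hm : s 1 ≤ m) :
    ∃ t, Exec m (emitSelected (g.map (· + 5))) s
      (if s 1 = 1 then ((g.map (· + 5)).map s).inv else []) t ∧
      (∀ r ≥ 5, t r = s r) ∧ t 0 = s 0 ∧ t 1 = s 1 - 1 ∧ t 2 = s 2 := by
  by_cases h0 : s 1 = 0
  · exact ⟨s, by rw [if_neg (by omega)]; exact .ifzZero h0 (.skip s), by simp [h0]⟩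
  · have ha := Exec.assign (m := m) s 1 (.sub (.reg 1) (.const 1))
      (by simp only [RegExpr.value]; omega)
    simp only [RegExpr.value] at ha
    refine ⟨Function.update s 1 (s 1 - 1), ?_, fun r hr => ?_, ?_, ?_, ?_⟩
    · by_cases h1 : s 1 = 1
      · rw [if_pos h1]
        refine .ifzPos h0 (.seq (C := []) ha (.ifzZero (by simp [h1]) ?_))
        have h := exec_emitList m (Function.update s 1 (s 1 - 1)) (g.map (· + 5)).inv
        rw [← Gate.inv_map] at h
        convert h using 2
        cases g <;> simp [Gate.map, Gate.inv]
      · rw [if_neg h1]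
        exact .ifzPos h0 (.seq (C := []) ha (.ifzPos (by simp; omega) (.skip _)))
    · rw [Function.update_of_ne (by omega)]
    all_goals simp

/-- The counter starts at `c + 1`, so it equals `1` exactly at index `c`; afterwards it stays at
zero and nothing more is written. -/
theorem transduce_selected (c : ℕ) (C : List Gate) :
    transduce (fun c g => if c = 1 then g.inv else []) (fun c _ => c - 1) (c + 1) C =
      C[c]?.toList.flatMap Gate.inv := by
  have h0 : ∀ C : List Gate,
      transduce (fun c g => if c = 1 then g.inv else []) (fun c _ => c - 1) 0 C = [] := by
    intro C
    induction C with
    | nil => rfl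
    | cons g C ih => simpa [transduce] using ih
  induction C generalizing c with
  | nil => simp [transduce]
  | cons g C ih =>
    cases c with
    | zero => simp [transduce, h0]
    | succ c =>
      simpa [transduce] using ih c

theorem invCircuit_take_succ (c : ℕ) (C : List Gate) :
    invCircuit (C.take (c + 1)) = C[c]?.toList.flatMap Gate.inv ++ invCircuit (C.take c) := by
  rw [invCircuit, invCircuit, List.take_add_one, List.reverse_append, List.flatMap_append]
  cases C[c]? <;> simp

/-- A circuit is too long to be stored, so its reversal is produced by running the generator once
per position, from the last to the first, each time letting only the selected gate through. -/
theorem UniformFamily.restartable_invCircuit {C : ℕ → List Gate} (hC : UniformFamily C) :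
    RestartableFamily (fun n => invCircuit (C n)) := by
  obtain ⟨prog, p, h⟩ := hC
  obtain ⟨e, he⟩ := exists_regExpr p
  refine ⟨.seq (.assign 2 e) (.loop 2 (.seq (.assign 1 (.reg 2))
    (.seq (prog.restart 5 emitSelected) (.assign 2 (.sub (.reg 2) (.const 1)))))),
    -- The factor `7` accounts for the inverse of `T`, which takes seven gates.
    Polynomial.C 7 * p + Polynomial.X, fun n s hs => ?_⟩
  obtain ⟨hl, t, ht⟩ := h n
  simp only [Polynomial.eval_add, Polynomial.eval_X, Polynomial.eval_mul, Polynomial.eval_C]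
  set m := 7 * p.eval n + n with hm
  have key : ∀ (c : ℕ) (u : ℕ → ℕ), c ≤ p.eval n → u 0 = n → u 2 = c → ∃ v,
      Exec m (.loop 2 (.seq (.assign 1 (.reg 2))
        (.seq (prog.restart 5 emitSelected) (.assign 2 (.sub (.reg 2) (.const 1)))))) u
        (invCircuit ((C n).take c)) v ∧ v 0 = n := by
    intro c
    induction c with
    | zero => exact fun u _ h0 h2 => ⟨u, by simpa [invCircuit] using Exec.loopDone h2, h0⟩
    | succ c ih =>
      intro u hc h0 h2
      have a1 := Exec.assign (m := m) u 1 (.reg 2) (by simp only [RegExpr.value]; omega)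
      simp only [RegExpr.value, h2] at a1
      obtain ⟨v, b1, -, b3, b4⟩ := Exec.restart (m' := m) (K := 5) (by omega) (by omega) (by omega)
        emitSelected (fun c g => if c = 1 then g.inv else []) (fun c _ => c - 1)
        (fun _ => True) (fun c _ => Nat.sub_le c 1)
        (fun g s hs _ => exec_emitSelected g s (hs.trans (by omega : c + 1 ≤ m)))
        ht (by simp) (Function.update u 1 (c + 1)) (by simpa) (by simp)
      rw [Function.update_self, transduce_selected] at b1
      rw [Function.update_of_ne (by omega), h2] at b4
      have a2 := Exec.assign (m := m) v 2 (.sub (.reg 2) (.const 1))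
        (by simp only [RegExpr.value]; omega)
      simp only [RegExpr.value, b4, Nat.add_sub_cancel] at a2
      obtain ⟨w, c1, c2⟩ := ih (Function.update v 2 c) (by omega) (by simpa) (by simp)
      refine ⟨w, ?_, c2⟩
      rw [invCircuit_take_succ]
      refine .loopStep (by omega) (.seq (C := []) a1 ?_) c1
      have b := Exec.seq b1 a2
      rwa [List.append_nil] at b
  have a1 := Exec.assign (m := m) s 2 e (by rw [he, hs]; omega)
  rw [he, hs] at a1
  obtain ⟨v, hv, hv0⟩ := key (p.eval n) (Function.update s 2 (p.eval n)) le_rfl (by simpa) (by simp)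
  -- The countdown begins at the bound `p(n)` because the true length is not known; positions past
  -- the end write nothing.
  rw [List.take_of_length_le hl] at hv
  refine ⟨?_, v, .seq (C := []) a1 hv, hv0⟩
  have : ∀ C : List Gate, (invCircuit C).length ≤ 7 * C.length := by
    intro C
    induction C with
    | nil => simp [invCircuit]
    | cons g C ih =>
      have hg : g.inv.length ≤ 7 := by cases g <;> simp [Gate.inv]
      simp only [invCircuit, List.reverse_cons, List.flatMap_append, List.length_append,
        List.length_cons, List.flatMap_singleton] at ih ⊢
      omega
  have := this (C n)
  omega

/-! ### Uniform generation of the copying circuit -/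

/-- The circuit that copies the wires `1, …, l` to the wires `Q, …, Q + l - 1`. -/
def copyCircuit (Q : ℕ) : ℕ → List Gate
  | 0 => []
  | l + 1 => .cnot (l + 1) (Q + l) :: copyCircuit Q l

theorem length_copyCircuit (Q l : ℕ) : (copyCircuit Q l).length = l := by
  induction l with
  | zero => rfl
  | succ l ih => simp [copyCircuit, ih]

theorem LogspaceComputable.restartable_copyCircuit {f : ℕ → ℕ} (hf : LogspaceComputable f)
    (hb : PolyBounded f) (Q : Polynomial ℕ) :
    RestartableFamily (fun n => copyCircuit (Q.eval n) (f n)) := by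
  obtain ⟨prog, p, h⟩ := hf
  obtain ⟨r, hr⟩ := hb
  obtain ⟨e, he⟩ := exists_regExpr Q
  -- Register `0` of the simulated program is register `5`, so the computed length is already in
  -- place as the loop variable.
  refine ⟨.seq (prog.restart 5 fun _ => .skip) (.loop 5 (.seq (.assign 1 (.reg 5))
    (.seq (.assign 5 (.sub (.reg 5) (.const 1))) (.seq (.assign 2 (.add e (.reg 5)))
    (.emit (.cnot 1 2)))))), p + r + Q + Polynomial.X, fun n s hs => ?_⟩
  obtain ⟨t, ht, ht0⟩ := h n
  have hr := hr n
  simp only [Polynomial.eval_add, Polynomial.eval_X, length_copyCircuit]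
  set m := p.eval n + r.eval n + Q.eval n + n with hm
  obtain ⟨v, b1, b2, b3, -⟩ := Exec.restart (m' := m) (K := 5) (by omega) (by omega) (by omega)
    (fun _ => .skip) (fun _ _ => []) (fun c _ => c) (fun _ => True) (fun _ _ => le_rfl)
    (fun g s _ _ => ⟨s, .skip s, by simp⟩) ht (by simp) s hs le_rfl
  have key : ∀ (c : ℕ) (u : ℕ → ℕ), c ≤ r.eval n → u 0 = n → u 5 = c → ∃ v,
      Exec m (.loop 5 (.seq (.assign 1 (.reg 5))
        (.seq (.assign 5 (.sub (.reg 5) (.const 1))) (.seq (.assign 2 (.add e (.reg 5)))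
        (.emit (.cnot 1 2)))))) u (copyCircuit (Q.eval n) c) v ∧ v 0 = n := by
    intro c
    induction c with
    | zero => exact fun u _ h0 h2 => ⟨u, .loopDone h2, h0⟩
    | succ c ih =>
      intro u hc h0 h2
      have a1 := Exec.assign (m := m) u 1 (.reg 5) (by simp only [RegExpr.value]; omega)
      simp only [RegExpr.value, h2] at a1
      set u1 := Function.update u 1 (c + 1) with hu1
      have h15 : u1 5 = c + 1 := by simp [hu1, h2]
      have a2 := Exec.assign (m := m) u1 5 (.sub (.reg 5) (.const 1))
        (by simp only [RegExpr.value]; omega)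
      simp only [RegExpr.value, h15, Nat.add_sub_cancel] at a2
      set u2 := Function.update u1 5 c with hu2
      have h25 : u2 5 = c := by simp [hu2]
      have h20 : u2 0 = n := by simp [hu2, hu1, h0]
      have a3 := Exec.assign (m := m) u2 2 (.add e (.reg 5))
        (by simp only [RegExpr.value, he, h25, h20]; omega)
      simp only [RegExpr.value, he, h25, h20] at a3
      set u3 := Function.update u2 2 (Q.eval n + c) with hu3
      have a4 := Exec.emit (m := m) u3 (.cnot 1 2)
      have h31 : u3 1 = c + 1 := by simp [hu3, hu2, hu1]
      have h32 : u3 2 = Q.eval n + c := by simp [hu3]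
      simp only [Gate.map, h31, h32] at a4
      obtain ⟨w, c1, c2⟩ := ih u3 (by omega) (by simp [hu3, h20]) (by simp [hu3, h25])
      exact ⟨w, .loopStep (by omega)
        (.seq (C := []) a1 (.seq (C := []) a2 (.seq (C := []) a3 a4))) c1, c2⟩
  have hnil : ∀ c, transduce (fun _ _ => []) (fun c (_ : Gate) => c) c [] = [] := fun _ => rfl
  rw [hnil] at b1
  obtain ⟨w, c1, c2⟩ := key (f n) v hr b3 (by rw [b2, ht0])
  exact ⟨by omega, w, .seq (C := []) b1 c1, c2⟩

/-! ### Circuits acting on functions of infinitely many wires -/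

/-- The action of a (proper) gate on functions of the contents of all wires. -/
def Gate.act : Gate → ((ℕ → Bool) → ℂ) → ((ℕ → Bool) → ℂ)
  | .had i, F => fun s =>
      (F (Function.update s i false) + (if s i then -1 else 1) * F (Function.update s i true)) /
        (Real.sqrt 2 : ℂ)
  | .tee i, F => fun s =>
      (if s i then Complex.exp (Complex.I * (Real.pi : ℂ) / 4) else 1) * F s
  | .cnot i j, F => fun s => F (Function.update s j (xor (s j) (s i)))

/-- The action of a circuit on functions of the contents of all wires. -/
def circuitAct (C : List Gate) (F : (ℕ → Bool) → ℂ) : (ℕ → Bool) → ℂ :=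
  C.foldl (fun F g => g.act F) F

theorem circuitAct_cons (g : Gate) (C : List Gate) (F : (ℕ → Bool) → ℂ) :
    circuitAct (g :: C) F = circuitAct C (g.act F) := rfl

theorem circuitAct_append (C D : List Gate) (F : (ℕ → Bool) → ℂ) :
    circuitAct (C ++ D) F = circuitAct D (circuitAct C F) := List.foldl_append

/-- The contents `c` with the wires `σ 0, …, σ (q - 1)` overwritten by `u`. -/
def embed (σ : ℕ → ℕ) (c : ℕ → Bool) {q : ℕ} (u : Bits q) : ℕ → Bool :=
  Function.extend (fun i : Fin q => σ i) u c

theorem embed_apply {σ : ℕ → ℕ} (hσ : Function.Injective σ) {q : ℕ}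
    (c : ℕ → Bool) (u : Bits q) (i : Fin q) : embed σ c u (σ i) = u i :=
  (hσ.comp Fin.val_injective).extend_apply u c i

theorem embed_wire {σ : ℕ → ℕ} (hσ : Function.Injective σ) {q : ℕ}
    (c : ℕ → Bool) (u : Bits q) {i : ℕ} (hi : i < q) :
    embed σ c u (σ i) = wire u i := by
  rw [wire, dif_pos hi]; exact embed_apply hσ c u ⟨i, hi⟩

theorem update_embed {σ : ℕ → ℕ} (hσ : Function.Injective σ) {q : ℕ}
    (c : ℕ → Bool) (u : Bits q) (i : Fin q) (b : Bool) :
    Function.update (embed σ c u) (σ i) b = embed σ c (Function.update u i b) := by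
  funext k
  by_cases hk : ∃ j : Fin q, σ j = k
  · obtain ⟨j, rfl⟩ := hk
    rw [embed_apply hσ]
    by_cases hj : j = i
    · subst hj; simp
    · rw [Function.update_of_ne hj, Function.update_of_ne, embed_apply hσ]
      exact fun h => hj (Fin.ext (hσ h))
  · rw [Function.update_of_ne (fun h => hk ⟨i, h.symm⟩)]
    simp only [embed]
    rw [Function.extend_apply' _ _ _ hk, Function.extend_apply' _ _ _ hk]

theorem sqrt_two_mul_self : (Real.sqrt 2 : ℂ) * (Real.sqrt 2 : ℂ) = 2 := by
  rw [← Complex.ofReal_mul, Real.mul_self_sqrt (by norm_num)]; norm_num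

theorem sqrt_two_ne_zero : (Real.sqrt 2 : ℂ) ≠ 0 := by
  rw [Complex.ofReal_ne_zero]; positivity

theorem had_mulVec {q : ℕ} (i : Fin q) (v : Bits q → ℂ) (u : Bits q) :
    ((Gate.had i).matrix q *ᵥ v) u =
      (v (Function.update u i false) + (if u i then -1 else 1) * v (Function.update u i true)) /
        (Real.sqrt 2 : ℂ) := by
  have h : ∀ t : Bits q, (∀ j : Fin q, (j : ℕ) ≠ i → u j = t j) ↔
      t ∈ ({Function.update u i false, Function.update u i true} : Finset (Bits q)) := by
    intro t
    rw [Finset.mem_insert, Finset.mem_singleton]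
    constructor
    · intro h
      have : t = Function.update u i (t i) := by
        rw [Function.eq_update_iff]
        exact ⟨rfl, fun j hj => (h j (fun h => hj (Fin.ext h))).symm⟩
      cases hb : t i <;> rw [hb] at this <;> simp [← this]
    · rintro (rfl | rfl) j hj <;>
        rw [Function.update_of_ne (fun h => hj (by rw [h]))]
  have hne : Function.update u i false ≠ Function.update u i true := by
    intro h
    have := congrFun h i
    simp at this
  simp only [Gate.matrix, if_pos i.2, Matrix.mulVec, dotProduct, Matrix.of_apply, h, ite_mul,
    zero_mul]
  rw [← Finset.sum_filter, Finset.filter_mem_eq_inter, Finset.univ_inter, Finset.sum_pair hne]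
  simp only [wire, i.2, dif_pos, Function.update_self]
  cases u i <;> simp <;> ring

theorem tee_mulVec {q : ℕ} (i : Fin q) (v : Bits q → ℂ) (u : Bits q) :
    ((Gate.tee i).matrix q *ᵥ v) u =
      (if u i then Complex.exp (Complex.I * (Real.pi : ℂ) / 4) else 1) * v u := by
  simp only [Gate.matrix, Matrix.mulVec_diagonal, wire, i.2, dif_pos]

/-- CNOT is an involution on basis states, so its matrix may be indexed by the image of the row
instead of the column; this is the form suited to acting on functions. -/
theorem cnot_apply {q : ℕ} {i j : Fin q} (hij : i ≠ j) (s t : Bits q) :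
    (Gate.cnot i j).matrix q s t =
      if t = Function.update s j (xor (s j) (s i)) then 1 else 0 := by
  simp only [Gate.matrix, if_neg (fun h => hij (Fin.ext h)), Matrix.of_apply]
  congr 1
  simp only [eq_iff_iff, funext_iff, wire, i.2, dif_pos]
  constructor
  · intro h k
    have hi := h i
    rw [if_neg (fun h => hij (Fin.ext h))] at hi
    by_cases hk : k = j
    · subst hk
      have := h k
      rw [if_pos rfl] at this
      rw [Function.update_self, this, hi]
      simp
    · rw [Function.update_of_ne hk, h k, if_neg (fun h => hk (Fin.ext h))]
  · intro h k
    have hi := h i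
    rw [Function.update_of_ne hij] at hi
    by_cases hk : k = j
    · subst hk
      rw [if_pos rfl, h k, Function.update_self, ← hi]
      simp [hi]
    · rw [if_neg (fun h => hk (Fin.ext h)), h k, Function.update_of_ne hk]

theorem cnot_mulVec {q : ℕ} {i j : Fin q} (hij : i ≠ j) (v : Bits q → ℂ) (u : Bits q) :
    ((Gate.cnot i j).matrix q *ᵥ v) u = v (Function.update u j (xor (u j) (u i))) := by
  simp [Matrix.mulVec, dotProduct, cnot_apply hij]

theorem Gate.act_map {σ : ℕ → ℕ} (hσ : Function.Injective σ) {q : ℕ} {g : Gate}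
    (hg : g.WellFormed q) (F : (ℕ → Bool) → ℂ) (c : ℕ → Bool) (u : Bits q) :
    (g.map σ).act F (embed σ c u) = (g.matrix q *ᵥ fun u => F (embed σ c u)) u := by
  cases g with
  | had i =>
    lift i to Fin q using hg
    rw [had_mulVec]
    simp only [Gate.map, Gate.act, update_embed hσ, embed_apply hσ]
  | tee i =>
    lift i to Fin q using hg
    rw [tee_mulVec]
    simp only [Gate.map, Gate.act, embed_apply hσ]
  | cnot i j =>
    obtain ⟨hi, hj, hij⟩ := hg
    lift i to Fin q using hi
    lift j to Fin q using hj
    rw [cnot_mulVec (fun h => hij (by rw [h]))]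
    simp only [Gate.map, Gate.act, update_embed hσ, embed_apply hσ]

/-- The contents `c` of the uninvolved wires are mere parameters. Infinitely many wires let circuits
of different widths be composed without casts; `σ` is the successor for the device inside the test
and the identity for the whole test. -/
theorem circuitAct_map {σ : ℕ → ℕ} (hσ : Function.Injective σ) {q : ℕ} {C : List Gate}
    (hC : ∀ g ∈ C, g.WellFormed q) (F : (ℕ → Bool) → ℂ) (c : ℕ → Bool) :
    (fun u => circuitAct (C.map (Gate.map σ)) F (embed σ c u)) =
      circuitMatrix q C *ᵥ fun u => F (embed σ c u) := by
  induction C generalizing F with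
  | nil => simp [circuitAct, circuitMatrix]
  | cons g C ih =>
    rw [List.map_cons, circuitMatrix, ← Matrix.mulVec_mulVec]
    simp only [circuitAct_cons]
    rw [ih (fun g hg => hC g (List.mem_cons_of_mem _ hg))]
    congr 1
    funext u
    exact Gate.act_map hσ (hC g List.mem_cons_self) F c u

/-! ### Unitarity and inverses -/

theorem had_conjTranspose {q i : ℕ} (hi : i < q) :
    ((Gate.had i).matrix q)ᴴ = (Gate.had i).matrix q := by
  ext s t
  simp only [Gate.matrix, if_pos hi, Matrix.conjTranspose_apply, Matrix.of_apply]
  simp only [eq_comm (a := t _), Bool.and_comm (wire t i)]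
  split_ifs <;> simp

theorem update_xor_update_xor {q : ℕ} {i j : Fin q} (hij : i ≠ j) (s : Bits q) :
    Function.update (Function.update s j (xor (s j) (s i))) j
      (xor ((Function.update s j (xor (s j) (s i))) j)
        ((Function.update s j (xor (s j) (s i))) i)) = s := by
  rw [Function.update_idem, Function.update_self, Function.update_of_ne hij]
  simp

theorem cnot_conjTranspose {q : ℕ} {i j : Fin q} (hij : i ≠ j) :
    ((Gate.cnot i j).matrix q)ᴴ = (Gate.cnot i j).matrix q := by
  ext s t
  rw [Matrix.conjTranspose_apply, cnot_apply hij, cnot_apply hij]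
  have : s = Function.update t j (xor (t j) (t i)) ↔
      t = Function.update s j (xor (s j) (s i)) := by
    constructor <;> (intro h; rw [h, update_xor_update_xor hij])
  simp only [this]
  split_ifs <;> simp

theorem Gate.conjTranspose_matrix_mul {q : ℕ} {g : Gate} (hg : g.WellFormed q) :
    (g.matrix q)ᴴ * g.matrix q = 1 := by
  cases g with
  | had i =>
    rw [had_conjTranspose hg]
    lift i to Fin q using hg
    refine Matrix.toLin'.injective (LinearMap.ext fun v => funext fun u => ?_)
    simp only [Matrix.toLin'_apply, ← Matrix.mulVec_mulVec, had_mulVec, Matrix.one_mulVec,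
      Function.update_self, Function.update_idem]
    have h2 := sqrt_two_mul_self
    have h0 := sqrt_two_ne_zero
    have hu := Function.update_eq_self i u
    cases hb : u i <;> rw [hb] at hu <;> simp [hu] <;> field_simp <;>
      linear_combination (-(v u)) * h2
  | tee i =>
    have h : ‖Complex.exp (Complex.I * (Real.pi : ℂ) / 4)‖ = 1 := by
      rw [Complex.norm_exp]; simp
    simp only [Gate.matrix, Matrix.diagonal_conjTranspose, Matrix.diagonal_mul_diagonal]
    rw [Matrix.diagonal_eq_one]
    funext s
    simp only [Pi.star_apply]
    split_ifs
    · rw [Complex.star_def, ← Complex.normSq_eq_conj_mul_self, Complex.normSq_eq_norm_sq, h]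
      simp
    · simp
  | cnot i j =>
    obtain ⟨hi, hj, hij⟩ := hg
    lift i to Fin q using hi
    lift j to Fin q using hj
    have hij' : i ≠ j := fun h => hij (by rw [h])
    rw [cnot_conjTranspose hij']
    refine Matrix.toLin'.injective (LinearMap.ext fun v => funext fun u => ?_)
    simp only [Matrix.toLin'_apply, ← Matrix.mulVec_mulVec, cnot_mulVec hij', Matrix.one_mulVec]
    rw [update_xor_update_xor hij']

theorem conjTranspose_circuitMatrix_mul {q : ℕ} {C : List Gate}
    (hC : ∀ g ∈ C, g.WellFormed q) : (circuitMatrix q C)ᴴ * circuitMatrix q C = 1 := by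
  induction C with
  | nil => simp [circuitMatrix]
  | cons g C ih =>
    have h := ih (fun g hg => hC g (List.mem_cons_of_mem _ hg))
    rw [circuitMatrix, Matrix.conjTranspose_mul, Matrix.mul_assoc,
      ← Matrix.mul_assoc _ _ (g.matrix q), h, Matrix.one_mul,
      Gate.conjTranspose_matrix_mul (hC g List.mem_cons_self)]

theorem Gate.WellFormed.inv {q : ℕ} {g : Gate} (hg : g.WellFormed q) :
    ∀ h ∈ g.inv, h.WellFormed q := by
  cases g <;> simpa [Gate.inv] using hg

theorem invCircuit_cons (g : Gate) (C : List Gate) :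
    invCircuit (g :: C) = invCircuit C ++ g.inv := by
  simp [invCircuit]

theorem wellFormed_invCircuit {q : ℕ} {C : List Gate} (hC : ∀ g ∈ C, g.WellFormed q) :
    ∀ g ∈ invCircuit C, g.WellFormed q := by
  intro g hg
  simp only [invCircuit, List.mem_flatMap, List.mem_reverse] at hg
  obtain ⟨h, hh, hg⟩ := hg
  exact (hC h hh).inv g hg

theorem circuitMatrix_append (q : ℕ) (C D : List Gate) :
    circuitMatrix q (C ++ D) = circuitMatrix q D * circuitMatrix q C := by
  induction C with
  | nil => simp [circuitMatrix]
  | cons g C ih => rw [List.cons_append, circuitMatrix, ih, circuitMatrix, Matrix.mul_assoc]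

theorem Gate.circuitMatrix_inv {q : ℕ} {g : Gate} (hg : g.WellFormed q) :
    circuitMatrix q g.inv * g.matrix q = 1 := by
  have h := Gate.conjTranspose_matrix_mul hg
  cases g with
  | had i =>
    rw [had_conjTranspose hg] at h
    simpa [Gate.inv, circuitMatrix] using h
  | tee i =>
    simp only [Gate.inv, List.replicate, circuitMatrix, Matrix.one_mul, Gate.matrix,
      Matrix.diagonal_mul_diagonal]
    rw [Matrix.diagonal_eq_one]
    funext s
    split_ifs
    -- `T` has order eight, so its seventh power is its inverse.
    · have h8 : Complex.exp (Complex.I * (Real.pi : ℂ) / 4) ^ 8 = 1 := by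
        rw [← Complex.exp_nat_mul, Complex.exp_eq_one_iff]
        exact ⟨1, by push_cast; ring⟩
      simp only [Pi.one_apply]
      linear_combination h8
    · simp
  | cnot i j =>
    obtain ⟨hi, hj, hij⟩ := hg
    lift i to Fin q using hi
    lift j to Fin q using hj
    rw [cnot_conjTranspose (fun h => hij (by rw [h]))] at h
    simpa [Gate.inv, circuitMatrix] using h

theorem circuitMatrix_invCircuit {q : ℕ} {C : List Gate} (hC : ∀ g ∈ C, g.WellFormed q) :
    circuitMatrix q (invCircuit C) = (circuitMatrix q C)ᴴ := by
  have h : circuitMatrix q (invCircuit C) * circuitMatrix q C = 1 := by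
    induction C with
    | nil => simp [invCircuit, circuitMatrix]
    | cons g C ih =>
      have h := ih (fun g hg => hC g (List.mem_cons_of_mem _ hg))
      rw [invCircuit_cons, circuitMatrix_append, circuitMatrix, Matrix.mul_assoc,
        ← Matrix.mul_assoc _ _ (g.matrix q), h, Matrix.one_mul,
        Gate.circuitMatrix_inv (hC g List.mem_cons_self)]
  -- Both sides are left inverses of the same square matrix.
  rw [← Matrix.inv_eq_left_inv h, Matrix.inv_eq_left_inv (conjTranspose_circuitMatrix_mul hC)]

/-! ### Bob's observables -/

theorem star_dotProduct_self {ι : Type*} [Fintype ι] (v : ι → ℂ) :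
    star v ⬝ᵥ v = ((∑ i, ‖v i‖ ^ 2 : ℝ) : ℂ) := by
  simp only [dotProduct, Pi.star_apply, Complex.star_def, Complex.conj_mul', Complex.ofReal_sum,
    Complex.ofReal_pow]

theorem star_mulVec_dotProduct {ι : Type*} [Fintype ι] (A B : Matrix ι ι ℂ) (v : ι → ℂ) :
    star (A *ᵥ v) ⬝ᵥ (B *ᵥ v) = star v ⬝ᵥ ((Aᴴ * B) *ᵥ v) := by
  rw [Matrix.star_mulVec, ← Matrix.dotProduct_mulVec, Matrix.mulVec_mulVec]

theorem sum_norm_sq_mulVec {ι : Type*} [Fintype ι] [DecidableEq ι] {U : Matrix ι ι ℂ}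
    (hU : Uᴴ * U = 1) (v : ι → ℂ) : ∑ i, ‖(U *ᵥ v) i‖ ^ 2 = ∑ i, ‖v i‖ ^ 2 := by
  have h := star_mulVec_dotProduct U U v
  rw [hU, Matrix.one_mulVec, star_dotProduct_self, star_dotProduct_self] at h
  exact_mod_cast h

/-! ### Ancillas -/

/-- The content of the last `a` wires is zero. -/
def IsPadded {q a : ℕ} (s : Bits (q + a)) : Prop := ∀ i : Fin a, s (Fin.natAdd q i) = false

instance {q a : ℕ} (s : Bits (q + a)) : Decidable (IsPadded s) :=
  inferInstanceAs (Decidable (∀ _, _))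

theorem isPadded_append {q : ℕ} (a : ℕ) (u : Bits q) :
    IsPadded (Fin.append u fun _ : Fin a => false) := fun i => by rw [Fin.append_right]

theorem IsPadded.eq_append {q a : ℕ} {s : Bits (q + a)} (hs : IsPadded s) :
    Fin.append (fun i => s (Fin.castAdd a i)) (fun _ => false) = s := by
  funext i
  induction i using Fin.addCases with
  | left i => rw [Fin.append_left]
  | right i => rw [Fin.append_right, hs i]

theorem sum_isPadded {M : Type*} [AddCommMonoid M] {q a : ℕ} (f : Bits (q + a) → M) :
    ∑ s, (if IsPadded s then f s else 0) = ∑ u : Bits q, f (Fin.append u fun _ => false) := by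
  rw [← Finset.sum_filter]
  refine Finset.sum_nbij' (fun s i => s (Fin.castAdd a i)) (fun u => Fin.append u fun _ => false)
    (by simp) (by simp [isPadded_append]) ?_ ?_ ?_
  · intro s hs
    exact IsPadded.eq_append (by simpa using hs)
  · intro u _
    funext i
    rw [Fin.append_left]
  · intro s hs
    rw [IsPadded.eq_append (by simpa using hs)]

/-- The tensor product of a vector with `a` qubits in state zero. -/
def padVec {q : ℕ} (a : ℕ) (v : Bits q → ℂ) : Bits (q + a) → ℂ :=
  fun s => if IsPadded s then v (fun i => s (Fin.castAdd a i)) else 0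

theorem padVec_append {q : ℕ} (a : ℕ) (v : Bits q → ℂ) (u : Bits q) :
    padVec a v (Fin.append u fun _ => false) = v u := by
  rw [padVec, if_pos (isPadded_append a u)]
  congr 1
  funext i
  rw [Fin.append_left]

theorem padVec_of_not {q a : ℕ} (v : Bits q → ℂ) {s : Bits (q + a)} (hs : ¬ IsPadded s) :
    padVec a v s = 0 := if_neg hs

/-- An isometry whose compression to the subspace with zero ancillas is an isometry leaves this
subspace invariant. -/
theorem mulVec_padVec {q a : ℕ} {U : Matrix (Bits (q + a)) (Bits (q + a)) ℂ} (hU : Uᴴ * U = 1)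
    {T : Matrix (Bits q) (Bits q) ℂ} (hT : Tᴴ * T = 1)
    (hTU : T = U.submatrix (fun s => Fin.append s fun _ => false)
      (fun s => Fin.append s fun _ => false)) (v : Bits q → ℂ) :
    U *ᵥ padVec a v = padVec a (T *ᵥ v) := by
  have h1 : ∀ u, (U *ᵥ padVec a v) (Fin.append u fun _ => false) = (T *ᵥ v) u := by
    intro u
    simp only [Matrix.mulVec, dotProduct, hTU, Matrix.submatrix_apply]
    have h := sum_isPadded (q := q) (a := a)
      (fun s => U (Fin.append u fun _ => false) s * padVec a v s)
    simp only [padVec_append] at h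
    rw [← h]
    refine Finset.sum_congr rfl fun s _ => ?_
    split_ifs with hs
    · rfl
    · rw [padVec_of_not v hs, mul_zero]
  -- The whole vector has norm `‖v‖`, and so has its padded part, which is `T v` by `h1`. Hence
  -- every component with a nonzero ancilla vanishes.
  have h2 : ∑ s, ‖(U *ᵥ padVec a v) s‖ ^ 2 =
      ∑ s, if IsPadded s then ‖(U *ᵥ padVec a v) s‖ ^ 2 else 0 := by
    rw [sum_isPadded, sum_norm_sq_mulVec hU]
    simp only [h1]
    rw [sum_norm_sq_mulVec hT]
    have h := sum_isPadded (q := q) (a := a) (fun s => ‖padVec a v s‖ ^ 2)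
    simp only [padVec_append] at h
    rw [← h]
    refine Finset.sum_congr rfl fun s _ => ?_
    split_ifs with hs
    · rfl
    · rw [padVec_of_not v hs]; simp
  rw [← sub_eq_zero, ← Finset.sum_sub_distrib, Finset.sum_eq_zero_iff_of_nonneg] at h2
  · funext s
    by_cases hs : IsPadded s
    · rw [← hs.eq_append, h1, padVec_append]
    · rw [padVec_of_not _ hs]
      simpa [hs] using h2 s (Finset.mem_univ s)
  · intro s _
    split_ifs <;> simp

/-- The Pauli matrix `Z` on wire `0`. -/
def signZ (q : ℕ) : Matrix (Bits q) (Bits q) ℂ :=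
  Matrix.diagonal fun s => if wire s 0 then -1 else 1

theorem bitProj_sub (q : ℕ) : bitProj q false - bitProj q true = signZ q := by
  rw [bitProj, bitProj, signZ, Matrix.diagonal_sub]
  congr 1
  funext s
  cases wire s 0 <;> simp

theorem bitProj_add (q : ℕ) : bitProj q false + bitProj q true = 1 := by
  rw [bitProj, bitProj, Matrix.diagonal_add, Matrix.diagonal_eq_one]
  funext s
  cases wire s 0 <;> simp

theorem signZ_mul_self (q : ℕ) : signZ q * signZ q = 1 := by
  rw [signZ, Matrix.diagonal_mul_diagonal, Matrix.diagonal_eq_one]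
  funext s
  cases wire s 0 <;> simp

theorem signZ_conjTranspose (q : ℕ) : (signZ q)ᴴ = signZ q := by
  rw [signZ, Matrix.diagonal_conjTranspose]
  congr 1
  funext s
  cases h : wire s 0 <;> simp [h]

theorem QPTCircuits.conjTranspose_matrix_mul {q : ℕ → ℕ} (D : QPTCircuits q) (n : ℕ) :
    (D.matrix n)ᴴ * D.matrix n = 1 := conjTranspose_circuitMatrix_mul (D.wellFormed n)

namespace CompiledModel

variable {X Y : Type} {S : EncScheme X} (M : CompiledModel S Y)

/-- The unitary `V† Z V` that measures the second-round answer coherently. -/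
def dilation (n : ℕ) (y : Y) :
    Matrix (Bits (M.q n + M.anc n)) (Bits (M.q n + M.anc n)) ℂ :=
  ((M.second y).matrix n)ᴴ * signZ (M.q n + M.anc n) * (M.second y).matrix n

theorem dilation_isometry (n : ℕ) (y : Y) : (M.dilation n y)ᴴ * M.dilation n y = 1 := by
  have h : (M.second y).matrix n * ((M.second y).matrix n)ᴴ = 1 :=
    mul_eq_one_comm.mp ((M.second y).conjTranspose_matrix_mul n)
  have h' := (M.second y).conjTranspose_matrix_mul n
  simp only [dilation, Matrix.conjTranspose_mul, Matrix.conjTranspose_conjTranspose,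
    signZ_conjTranspose]
  generalize (M.second y).matrix n = V at *
  calc Vᴴ * (signZ _ * V) * (Vᴴ * signZ _ * V)
      = Vᴴ * signZ _ * (V * Vᴴ) * signZ _ * V := by simp only [Matrix.mul_assoc]
    _ = 1 := by rw [h, Matrix.mul_one, Matrix.mul_assoc Vᴴ, signZ_mul_self, Matrix.mul_one, h']

theorem bobObs_eq (n : ℕ) (y : Y) : M.bobObs n y = (M.dilation n y).submatrix
    (fun s => Fin.append s fun _ => false) (fun s => Fin.append s fun _ => false) := by
  rw [bobObs, povm, povm, dilation, ← bitProj_sub, Matrix.mul_sub, Matrix.sub_mul,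
    Matrix.submatrix_sub]
  rfl

theorem povm_add (n : ℕ) (y : Y) : M.povm n y false + M.povm n y true = 1 := by
  have h : M.povm n y false + M.povm n y true =
      (1 : Matrix (Bits (M.q n + M.anc n)) (Bits (M.q n + M.anc n)) ℂ).submatrix
      (fun s => Fin.append s fun _ => false) (fun s => Fin.append s fun _ => false) := by
    rw [← (M.second y).conjTranspose_matrix_mul n, ← Matrix.mul_one ((M.second y).matrix n)ᴴ,
      ← bitProj_add, Matrix.mul_add, Matrix.add_mul, Matrix.submatrix_add]
    rfl
  rw [h]
  refine Matrix.submatrix_one _ fun s t hst => ?_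
  funext i
  simpa [Fin.append_left] using congrFun hst (Fin.castAdd _ i)

variable {M}

theorem bobObs_conjTranspose (hM : M.IsProjective) (n : ℕ) (y : Y) :
    (M.bobObs n y)ᴴ = M.bobObs n y := by
  have h0 := (hM n y false).isSelfAdjoint.star_eq
  have h1 := (hM n y true).isSelfAdjoint.star_eq
  rw [Matrix.star_eq_conjTranspose] at h0 h1
  rw [bobObs, Matrix.conjTranspose_sub, h0, h1]

/-- The two outcomes sum to the identity, so the observable is `2N - 1` with `N` a projection, a
reflection. -/
theorem bobObs_mul_self (hM : M.IsProjective) (n : ℕ) (y : Y) :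
    M.bobObs n y * M.bobObs n y = 1 := by
  have h0 : M.povm n y false * M.povm n y false = M.povm n y false :=
    (hM n y false).isIdempotentElem
  have h1 : M.povm n y true = 1 - M.povm n y false := by rw [← M.povm_add n y]; abel
  rw [bobObs, h1]
  have : (M.povm n y false - (1 - M.povm n y false)) * (M.povm n y false - (1 - M.povm n y false))
      = 4 • (M.povm n y false * M.povm n y false) - 4 • M.povm n y false + 1 := by noncomm_ring
  rw [this, h0]; simp

theorem bobOp_conjTranspose (hM : M.IsProjective) (n : ℕ) (w : List Y) :
    (M.bobOp n w)ᴴ = M.bobOp n w.reverse := by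
  induction w with
  | nil => simp [bobOp]
  | cons y w ih =>
    simp only [bobOp, List.map_cons, List.prod_cons, List.reverse_cons, List.map_append,
      List.prod_append, Matrix.conjTranspose_mul] at ih ⊢
    rw [ih, bobObs_conjTranspose hM]
    simp

theorem bobOp_isometry (hM : M.IsProjective) (n : ℕ) (w : List Y) :
    (M.bobOp n w)ᴴ * M.bobOp n w = 1 := by
  induction w with
  | nil => simp [bobOp]
  | cons y w ih =>
    simp only [bobOp, List.map_cons, List.prod_cons, Matrix.conjTranspose_mul] at ih ⊢
    rw [Matrix.mul_assoc, ← Matrix.mul_assoc _ (M.bobObs n y), bobObs_conjTranspose hM,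
      bobObs_mul_self hM, Matrix.one_mul, ih]

/-- Here projectivity pays: for a general POVM the compression would not be an isometry, and the
ancillas could not be reused for the next letter. -/
theorem dilation_mulVec_padVec (hM : M.IsProjective) (n : ℕ) (y : Y) (v : Bits (M.q n) → ℂ) :
    M.dilation n y *ᵥ padVec (M.anc n) v = padVec (M.anc n) (M.bobObs n y *ᵥ v) :=
  mulVec_padVec (M.dilation_isometry n y)
    (by rw [bobObs_conjTranspose hM, bobObs_mul_self hM]) (M.bobObs_eq n y) v

end CompiledModel

/-! ### Controlled observables -/

theorem addOne_injective : Function.Injective (· + 1 : ℕ → ℕ) := add_left_injective 1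

theorem embed_succ_of_lt {q : ℕ} (c : ℕ → Bool) (u : Bits q) {k : ℕ} (hk : q < k) :
    embed (· + 1) c u k = c k := by
  refine Function.extend_apply' _ _ _ ?_
  rintro ⟨i, hi⟩
  have := i.2
  dsimp only at hi
  omega

theorem embed_succ_zero {q : ℕ} (c : ℕ → Bool) (u : Bits q) : embed (· + 1) c u 0 = c 0 := by
  refine Function.extend_apply' _ _ _ ?_
  rintro ⟨i, hi⟩
  simp at hi

/-- The vector of the `q` qubits on the wires `1, …, q` for given contents of the other wires. -/
def slice (q : ℕ) (F : (ℕ → Bool) → ℂ) (c : ℕ → Bool) : Bits q → ℂ :=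
  fun u => F (embed (· + 1) c u)

theorem embed_slice_self (q : ℕ) (s : ℕ → Bool) :
    embed (· + 1) s (fun i : Fin q => s (i + 1)) = s := by
  funext k
  by_cases hk : ∃ i : Fin q, (i : ℕ) + 1 = k
  · obtain ⟨i, rfl⟩ := hk
    exact embed_apply addOne_injective _ _ i
  · exact Function.extend_apply' _ _ _ hk

theorem slice_self (q : ℕ) (F : (ℕ → Bool) → ℂ) (s : ℕ → Bool) :
    slice q F s (fun i => s (i + 1)) = F s := by
  rw [slice, embed_slice_self]

theorem slice_circuitAct {q : ℕ} {C : List Gate} (hC : ∀ g ∈ C, g.WellFormed q)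
    (F : (ℕ → Bool) → ℂ) (c : ℕ → Bool) :
    slice q (circuitAct (C.map (Gate.map (· + 1))) F) c = circuitMatrix q C *ᵥ slice q F c :=
  circuitAct_map addOne_injective hC F c

/-- The wires `q + 1, …, Q - 1` contain zeros throughout the state. -/
def ZeroBetween (q Q : ℕ) (F : (ℕ → Bool) → ℂ) : Prop :=
  ∀ s : ℕ → Bool, (∃ k, q < k ∧ k < Q ∧ s k = true) → F s = 0

theorem ZeroBetween.slice_eq_zero {q Q : ℕ} {F : (ℕ → Bool) → ℂ} (hF : ZeroBetween q Q F)
    {c : ℕ → Bool} (hc : ∃ k, q < k ∧ k < Q ∧ c k = true) : slice q F c = 0 := by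
  funext u
  obtain ⟨k, h1, h2, h3⟩ := hc
  exact hF _ ⟨k, h1, h2, by rw [embed_succ_of_lt c u h1, h3]⟩

/-- The controlled `Z` gate with control `0` and target `1`. -/
def controlledZ : List Gate := [.had 1, .cnot 0 1, .had 1]

theorem circuitAct_controlledZ (F : (ℕ → Bool) → ℂ) (s : ℕ → Bool) :
    circuitAct controlledZ F s = (if s 0 && s 1 then -1 else 1) * F s := by
  have h2 := sqrt_two_mul_self
  have h0 := sqrt_two_ne_zero
  have hs := Function.update_eq_self 1 s
  simp only [controlledZ, circuitAct, List.foldl_cons, List.foldl_nil, Gate.act,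
    Function.update_self, Function.update_idem]
  simp only [Function.update_of_ne (show (0 : ℕ) ≠ 1 by omega)]
  cases hb : s 1 <;> cases hc : s 0 <;> rw [hb] at hs <;> simp [hs] <;> field_simp <;>
    first | linear_combination (-(F s)) * h2 | linear_combination F s * h2

theorem embed_add_eq {q a : ℕ} {c : ℕ → Bool} (hc : ∀ k, q < k → k ≤ q + a → c k = false)
    (u : Bits q) :
    embed (· + 1) c (Fin.append u fun _ : Fin a => false) = embed (· + 1) c u := by
  funext k
  rcases Nat.eq_zero_or_pos k with rfl | hk
  · rw [embed_succ_zero, embed_succ_zero]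
  obtain ⟨k, rfl⟩ : ∃ j, k = j + 1 := ⟨k - 1, by omega⟩
  by_cases h1 : k < q
  · have := embed_apply addOne_injective c (Fin.append u fun _ : Fin a => false)
      (Fin.castAdd a ⟨k, h1⟩)
    rw [Fin.append_left] at this
    exact this.trans (embed_apply addOne_injective c u ⟨k, h1⟩).symm
  · rw [embed_succ_of_lt c u (by omega)]
    by_cases h2 : k < q + a
    · have := embed_apply addOne_injective c (Fin.append u fun _ : Fin a => false)
        (Fin.natAdd q ⟨k - q, by omega⟩)
      rw [Fin.append_right, Fin.val_natAdd] at this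
      simp only [show q + (k - q) + 1 = k + 1 by omega] at this
      rw [this, hc _ (by omega) (by omega)]
    · rw [embed_succ_of_lt _ _ (by omega)]

/-- The ancilla wires can be viewed either as outer parameters or as part of the vector; on states
supported on zero ancillas the two views differ by padding. -/
theorem ZeroBetween.slice_add {q Q a : ℕ} {F : (ℕ → Bool) → ℂ} (hF : ZeroBetween q Q F)
    (ha : q + a < Q) {c : ℕ → Bool} (hc : ∀ k, q < k → k ≤ q + a → c k = false) :
    slice (q + a) F c = padVec a (slice q F c) := by
  funext s
  by_cases hs : IsPadded s
  · rw [← hs.eq_append, padVec_append, slice, embed_add_eq hc, slice]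
  · rw [padVec_of_not _ hs]
    rw [IsPadded] at hs
    push Not at hs
    obtain ⟨i, hi⟩ := hs
    refine hF _ ⟨q + i + 1, by omega, by omega, ?_⟩
    have := embed_apply addOne_injective c s (Fin.natAdd q i)
    rw [Fin.val_natAdd] at this
    rw [this]
    simpa using hi

namespace CompiledModel

variable {X Y : Type} {S : EncScheme X} (M : CompiledModel S Y)

/-- The observable `B_y` on the wires `1, …`, controlled by wire `0`. -/
def controlledBob (n : ℕ) (y : Y) : List Gate :=
  ((M.second y).gates n).map (Gate.map (· + 1)) ++ (controlledZ ++
    invCircuit (((M.second y).gates n).map (Gate.map (· + 1))))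

/-- A monomial in Bob's observables on the wires `1, …`, controlled by wire `0`. -/
def controlledWord (n : ℕ) : List Y → List Gate
  | [] => []
  | y :: w => controlledWord n w ++ M.controlledBob n y

end CompiledModel

theorem invCircuit_map (f : ℕ → ℕ) (C : List Gate) :
    invCircuit (C.map (Gate.map f)) = (invCircuit C).map (Gate.map f) := by
  induction C with
  | nil => rfl
  | cons g C ih => rw [List.map_cons, invCircuit_cons, ih, Gate.inv_map, invCircuit_cons,
      List.map_append]

namespace CompiledModel

variable {X Y : Type} {S : EncScheme X} {M : CompiledModel S Y}

/-- Only the `Z` in the middle is controlled: with control `0` the circuit collapses to `V† V = 1`,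
with control `1` it is `V† Z V`. -/
theorem slice_controlledBob_add {n Q : ℕ} (y : Y) (hQ : M.q n + M.anc n + 2 ≤ Q)
    {F : (ℕ → Bool) → ℂ} (hF : ZeroBetween (M.q n) Q F) (c : ℕ → Bool) :
    slice (M.q n + M.anc n) (circuitAct (M.controlledBob n y) F) c =
      if c 0 then M.dilation n y *ᵥ slice (M.q n + M.anc n) F c
      else slice (M.q n + M.anc n) F c := by
  have hV := (M.second y).conjTranspose_matrix_mul n
  have hwf := (M.second y).wellFormed n
  rw [controlledBob, circuitAct_append, circuitAct_append, invCircuit_map,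
    slice_circuitAct (wellFormed_invCircuit hwf), circuitMatrix_invCircuit hwf]
  set G := circuitAct (((M.second y).gates n).map (Gate.map (· + 1))) F with hG
  have h1 : slice (M.q n + M.anc n) G c =
      (M.second y).matrix n *ᵥ slice (M.q n + M.anc n) F c := slice_circuitAct hwf F c
  have h2 : slice (M.q n + M.anc n) (circuitAct controlledZ G) c =
      if c 0 then signZ (M.q n + M.anc n) *ᵥ slice (M.q n + M.anc n) G c
      else slice (M.q n + M.anc n) G c := by
    funext u
    rw [slice, circuitAct_controlledZ, embed_succ_zero]
    cases hc : c 0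
    · simp [slice]
    · simp only [if_true, signZ, Matrix.mulVec_diagonal, Bool.true_and]
      change _ = _ * G (embed (· + 1) c u)
      -- With no qubit at all in the second round, `signZ` is trivial while the circuit still
      -- addresses wire `1`; that wire is zero on the support of `F`.
      by_cases hq : 0 < M.q n + M.anc n
      · rw [← embed_wire addOne_injective c u hq]
      · by_cases hc1 : c 1 = true
        · have h0 : slice (M.q n + M.anc n) F c = 0 := by
            funext v
            exact hF _ ⟨1, by omega, by omega, by rw [embed_succ_of_lt c v (by omega), hc1]⟩
          have hz : G (embed (· + 1) c u) = 0 := by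
            have := congrFun h1 u
            rw [h0, Matrix.mulVec_zero] at this
            exact this
          rw [hz, mul_zero, mul_zero]
        · rw [embed_succ_of_lt c u (by omega), wire, dif_neg hq]
          simp [hc1]
  change ((M.second y).matrix n)ᴴ *ᵥ _ = _
  rw [h2, h1]
  split_ifs
  · rw [dilation, Matrix.mulVec_mulVec, Matrix.mulVec_mulVec, Matrix.mul_assoc]
  · rw [Matrix.mulVec_mulVec, hV, Matrix.one_mulVec]

theorem zeroBetween_controlledBob (hM : M.IsProjective) {n Q : ℕ} (y : Y)
    (hQ : M.q n + M.anc n + 2 ≤ Q) {F : (ℕ → Bool) → ℂ} (hF : ZeroBetween (M.q n) Q F) :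
    ZeroBetween (M.q n) Q (circuitAct (M.controlledBob n y) F) := by
  rintro s ⟨k, h1, h2, h3⟩
  rw [← slice_self (M.q n + M.anc n) (circuitAct (M.controlledBob n y) F) s,
    slice_controlledBob_add y hQ hF]
  by_cases hk : k ≤ M.q n + M.anc n
  -- The long slice does not depend on the outer contents of the ancilla wires, so they may be
  -- cleared to make `ZeroBetween.slice_add` applicable.
  · set c : ℕ → Bool := fun k => if M.q n < k ∧ k ≤ M.q n + M.anc n then false else s k with hc
    have hsc : slice (M.q n + M.anc n) F s = slice (M.q n + M.anc n) F c := by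
      funext u
      simp only [slice]
      congr 1
      funext j
      by_cases hj : ∃ i : Fin (M.q n + M.anc n), (i : ℕ) + 1 = j
      · obtain ⟨i, rfl⟩ := hj
        exact (embed_apply addOne_injective s u i).trans (embed_apply addOne_injective c u i).symm
      · rw [embed, embed, Function.extend_apply' _ _ _ hj, Function.extend_apply' _ _ _ hj]
        rw [hc]
        dsimp only
        rw [if_neg]
        rintro ⟨a, b⟩
        exact hj ⟨⟨j - 1, by omega⟩, by dsimp only; omega⟩
    have hs : ¬ IsPadded (fun i : Fin (M.q n + M.anc n) => s (i + 1)) := by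
      intro h
      have := h ⟨k - 1 - M.q n, by omega⟩
      simp only [Fin.val_natAdd] at this
      rw [show M.q n + (k - 1 - M.q n) + 1 = k by omega, h3] at this
      simp at this
    rw [hsc, hF.slice_add (by omega) (c := c) (fun j a b => by simp [hc, a, b]),
      dilation_mulVec_padVec hM]
    split_ifs <;> exact padVec_of_not _ hs
  -- Wires beyond the ancillas are not touched, so a nonzero one already made the amplitude vanish
  -- before.
  · have h0 : slice (M.q n + M.anc n) F s = 0 := by
      funext v
      exact hF _ ⟨k, h1, h2, by rw [embed_succ_of_lt s v (by omega), h3]⟩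
    rw [h0, Matrix.mulVec_zero]
    simp

/-- If `c` has zero ancillas, this is the action on the long slice with the padding removed;
otherwise both sides are zero. -/
theorem slice_controlledBob (hM : M.IsProjective) {n Q : ℕ} (y : Y)
    (hQ : M.q n + M.anc n + 2 ≤ Q) {F : (ℕ → Bool) → ℂ} (hF : ZeroBetween (M.q n) Q F)
    (c : ℕ → Bool) :
    slice (M.q n) (circuitAct (M.controlledBob n y) F) c =
      if c 0 then M.bobObs n y *ᵥ slice (M.q n) F c else slice (M.q n) F c := by
  by_cases hc : ∀ k, M.q n < k → k ≤ M.q n + M.anc n → c k = false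
  · have h := slice_controlledBob_add y hQ hF c
    rw [(zeroBetween_controlledBob hM y hQ hF).slice_add (by omega) hc, hF.slice_add (by omega) hc,
      dilation_mulVec_padVec hM] at h
    funext u
    have h := congrFun h (Fin.append u fun _ => false)
    rw [padVec_append] at h
    rw [h]
    split_ifs <;> rw [padVec_append]
  · push Not at hc
    obtain ⟨k, h1, h2, h3⟩ := hc
    have hk : ∃ k, M.q n < k ∧ k < Q ∧ c k = true := ⟨k, h1, by omega, by simpa using h3⟩
    rw [(zeroBetween_controlledBob hM y hQ hF).slice_eq_zero hk, hF.slice_eq_zero hk,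
      Matrix.mulVec_zero]
    simp

theorem slice_controlledWord (hM : M.IsProjective) {n Q : ℕ}
    (hQ : ∀ _ : Y, M.q n + M.anc n + 2 ≤ Q) (w : List Y) {F : (ℕ → Bool) → ℂ}
    (hF : ZeroBetween (M.q n) Q F) :
    ZeroBetween (M.q n) Q (circuitAct (M.controlledWord n w) F) ∧
    ∀ c, slice (M.q n) (circuitAct (M.controlledWord n w) F) c =
      if c 0 then M.bobOp n w *ᵥ slice (M.q n) F c else slice (M.q n) F c := by
  induction w with
  | nil => exact ⟨hF, fun c => by simp [controlledWord, circuitAct, bobOp]⟩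
  | cons y w ih =>
    obtain ⟨h1, h2⟩ := ih
    rw [controlledWord, circuitAct_append]
    refine ⟨zeroBetween_controlledBob hM y (hQ y) h1, fun c => ?_⟩
    rw [slice_controlledBob hM y (hQ y) h1, h2]
    split_ifs
    · rw [bobOp, bobOp, List.map_cons, List.prod_cons, Matrix.mulVec_mulVec]
    · rfl

end CompiledModel

/-! ### The Hadamard test as a distinguisher -/

theorem Gate.WellFormed.mono {q q' : ℕ} (h : q ≤ q') {g : Gate} (hg : g.WellFormed q) :
    g.WellFormed q' := by
  cases g with
  | had i | tee i => exact lt_of_lt_of_le hg h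
  | cnot i j => exact ⟨hg.1.trans_le h, hg.2.1.trans_le h, hg.2.2⟩

theorem Gate.WellFormed.map_succ {q q' : ℕ} (h : q + 1 ≤ q') {g : Gate} (hg : g.WellFormed q) :
    (g.map (· + 1)).WellFormed q' := by
  cases g with
  | had i | tee i =>
    have : i < q := hg
    simp only [Gate.map, Gate.WellFormed]; omega
  | cnot i j =>
    obtain ⟨h1, h2, h3⟩ := hg
    simp only [Gate.map, Gate.WellFormed]; omega

theorem wellFormed_map_succ {q q' : ℕ} (h : q + 1 ≤ q') {C : List Gate}
    (hC : ∀ g ∈ C, g.WellFormed q) : ∀ g ∈ C.map (Gate.map (· + 1)), g.WellFormed q' := by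
  intro g hg
  obtain ⟨g, hg', rfl⟩ := List.mem_map.mp hg
  exact (hC g hg').map_succ h

theorem wellFormed_append {q : ℕ} {C D : List Gate} (hC : ∀ g ∈ C, g.WellFormed q)
    (hD : ∀ g ∈ D, g.WellFormed q) : ∀ g ∈ C ++ D, g.WellFormed q := fun g hg =>
  (List.mem_append.mp hg).elim (hC g) (hD g)

theorem wellFormed_copyCircuit {Q l : ℕ} (h : l < Q) :
    ∀ g ∈ copyCircuit Q l, g.WellFormed (Q + l) := by
  induction l with
  | zero => simp [copyCircuit]
  | succ l ih =>
    intro g hg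
    rcases List.mem_cons.mp hg with rfl | hg
    · simp only [Gate.WellFormed]; omega
    · exact (ih (by omega) g hg).mono (by omega)

theorem PolyBounded.mono {f g : ℕ → ℕ} (hg : PolyBounded g) (h : ∀ n, f n ≤ g n) :
    PolyBounded f := by
  obtain ⟨p, hp⟩ := hg
  exact ⟨p, fun n => (h n).trans (hp n)⟩

namespace CompiledModel

variable {X Y : Type} {S : EncScheme X} (M : CompiledModel S Y)

/-- The circuit of the Hadamard test for a monomial in Bob's observables: control on wire `0`,
device on the wires `1, …`, and a coherent copy of the encrypted answer on the wires
`Q, Q + 1, …`. -/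
def hadamardTest (Q : Polynomial ℕ) (k : ℕ) (w : List Y) (n : ℕ) : List Gate :=
  [.had 0] ++ ((M.first.gates n).map (Gate.map (· + 1)) ++
    (copyCircuit (Q.eval n) (S.outLen n) ++ ((M.post.gates n).map (Gate.map (· + 1)) ++
      (List.replicate k (.tee 0) ++ (M.controlledWord n w ++ [.had 0])))))

theorem restartable_controlledWord (w : List Y) :
    RestartableFamily (fun n => M.controlledWord n w) := by
  induction w with
  | nil => exact .nil
  | cons y w ih =>
    exact ih.append ((M.second y).restartable_succ.append ((RestartableFamily.const _).append
      (M.second y).restartable_succ.uniform.restartable_invCircuit))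

theorem uniform_hadamardTest (Q : Polynomial ℕ) (k : ℕ) (w : List Y) :
    UniformFamily (M.hadamardTest Q k w) :=
  ((RestartableFamily.const _).append (M.first.restartable_succ.append
    ((M.outLen_uniform.restartable_copyCircuit (M.first.width_poly.mono M.outLen_le) Q).append
      (M.post.restartable_succ.append ((RestartableFamily.const _).append
        ((M.restartable_controlledWord w).append (RestartableFamily.const _))))))).uniform

theorem wellFormed_controlledWord {n W : ℕ} (hW : ∀ _ : Y, M.q n + M.anc n + 2 ≤ W)
    (w : List Y) : ∀ g ∈ M.controlledWord n w, g.WellFormed W := by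
  induction w with
  | nil => simp [controlledWord]
  | cons y w ih =>
    have hW := hW y
    have h : ∀ g ∈ ((M.second y).gates n).map (Gate.map (· + 1)), g.WellFormed W :=
      wellFormed_map_succ (by omega) ((M.second y).wellFormed n)
    refine wellFormed_append ih (wellFormed_append h (wellFormed_append ?_
      (wellFormed_invCircuit h)))
    simp only [controlledZ, List.mem_cons, List.not_mem_nil, or_false, forall_eq_or_imp, forall_eq,
      Gate.WellFormed]
    omega

theorem wellFormed_hadamardTest {Q : Polynomial ℕ} {n : ℕ} (hQ : M.q n + 2 ≤ Q.eval n)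
    (hQ' : ∀ _ : Y, M.q n + M.anc n + 2 ≤ Q.eval n) (k : ℕ) (w : List Y) :
    ∀ g ∈ M.hadamardTest Q k w n, g.WellFormed (Q.eval n + Q.eval n) := by
  have h0 : ∀ g ∈ [Gate.had 0], g.WellFormed (Q.eval n + Q.eval n) := by
    simp only [List.mem_singleton, forall_eq, Gate.WellFormed]; omega
  have hl := M.outLen_le n
  refine wellFormed_append h0 (wellFormed_append
    (wellFormed_map_succ (by omega) (M.first.wellFormed n)) (wellFormed_append ?_
    (wellFormed_append (wellFormed_map_succ (by omega) (M.post.wellFormed n))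
    (wellFormed_append ?_ (wellFormed_append ?_ h0)))))
  · exact fun g hg => (wellFormed_copyCircuit (by omega) g hg).mono (by omega)
  · intro g hg
    rw [List.eq_of_mem_replicate hg]
    simp only [Gate.WellFormed]; omega
  · exact M.wellFormed_controlledWord (fun y => (hQ' y).trans (by omega)) w

/-- The Hadamard test as a QPT circuit family. -/
def distinguisher (Q : Polynomial ℕ) (hQ : ∀ n, M.q n + 2 ≤ Q.eval n)
    (hQ' : ∀ n, ∀ _ : Y, M.q n + M.anc n + 2 ≤ Q.eval n) (k : ℕ) (w : List Y) :
    QPTCircuits (fun n => Q.eval n + Q.eval n) where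
  gates := M.hadamardTest Q k w
  width_poly := ⟨Q + Q, fun n => by simp⟩
  wellFormed n := M.wellFormed_hadamardTest (hQ n) (hQ' n) k w
  uniform := M.uniform_hadamardTest Q k w

end CompiledModel

/-! ### Analysis of the Hadamard test -/

/-- Since `l < Q`, no target is also a source, so every XOR is taken with original contents. -/
theorem circuitAct_copyCircuit {Q l : ℕ} (h : l < Q) (F : (ℕ → Bool) → ℂ) (s : ℕ → Bool) :
    circuitAct (copyCircuit Q l) F s =
      F (fun k => if Q ≤ k ∧ k < Q + l then xor (s k) (s (k - Q + 1)) else s k) := by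
  induction l generalizing F with
  | zero =>
    simp only [copyCircuit, circuitAct, List.foldl_nil]
    congr 1
    funext k
    rw [if_neg (by omega)]
  | succ l ih =>
    rw [copyCircuit, circuitAct_cons, ih (by omega)]
    change F _ = F _
    congr 1
    funext k
    dsimp only
    rw [if_neg (by omega), if_neg (by omega)]
    by_cases hk : k = Q + l
    · subst hk
      rw [Function.update_self, if_pos (by omega), show Q + l - Q + 1 = l + 1 by omega]
    · rw [Function.update_of_ne hk]
      by_cases hk' : Q ≤ k ∧ k < Q + l
      · rw [if_pos hk', if_pos (by omega)]
      · rw [if_neg hk', if_neg (by omega)]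

theorem update_embed_zero {q : ℕ} (c : ℕ → Bool) (u : Bits q) (b : Bool) :
    Function.update (embed (· + 1) c u) 0 b = embed (· + 1) (Function.update c 0 b) u := by
  funext k
  by_cases hk : ∃ i : Fin q, (i : ℕ) + 1 = k
  · obtain ⟨i, rfl⟩ := hk
    rw [Function.update_of_ne (by omega)]
    exact (embed_apply addOne_injective c u i).trans (embed_apply addOne_injective _ u i).symm
  · rw [embed, embed, Function.extend_apply' _ _ _ hk]
    by_cases h0 : k = 0
    · subst h0; simp
    · rw [Function.update_of_ne h0, Function.extend_apply' _ _ _ hk, Function.update_of_ne h0]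

theorem slice_had_zero (q : ℕ) (F : (ℕ → Bool) → ℂ) (c : ℕ → Bool) :
    slice q ((Gate.had 0).act F) c = (1 / (Real.sqrt 2 : ℂ)) •
      (slice q F (Function.update c 0 false) +
        (if c 0 then (-1 : ℂ) else 1) • slice q F (Function.update c 0 true)) := by
  funext u
  simp only [slice, Gate.act, Pi.smul_apply, Pi.add_apply, smul_eq_mul, update_embed_zero,
    embed_succ_zero]
  ring

theorem slice_tee_zero (q k : ℕ) (F : (ℕ → Bool) → ℂ) (c : ℕ → Bool) :
    slice q (circuitAct (List.replicate k (.tee 0)) F) c =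
      (if c 0 then Complex.exp (Complex.I * (Real.pi : ℂ) / 4) ^ k else 1) • slice q F c := by
  induction k generalizing F with
  | zero => simp [circuitAct]
  | succ k ih =>
    rw [List.replicate_succ, circuitAct_cons, ih]
    funext u
    simp only [slice, Gate.act, Pi.smul_apply, smul_eq_mul, embed_succ_zero]
    split_ifs <;> ring

/-- The contents of all wires: `χ` on the wires `1, …, c`, zeros elsewhere. -/
def initialContents {c : ℕ} (χ : Bits c) : ℕ → Bool := fun k =>
  if h : 1 ≤ k ∧ k - 1 < c then χ ⟨k - 1, h.2⟩ else false

open Classical in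
/-- The initial state of a distinguisher. -/
def initialState {c : ℕ} (χ : Bits c) : (ℕ → Bool) → ℂ := Pi.single (initialContents χ) 1

open Classical in
theorem initialState_wire {c W : ℕ} (h : c + 1 ≤ W) (χ : Bits c) (u : Bits W) :
    initialState χ (wire u) = inputVec W 1 χ u := by
  rw [initialState, inputVec, Pi.single_apply, Pi.single_apply]
  congr 1
  rw [eq_iff_iff, funext_iff, funext_iff]
  constructor
  · intro hu i
    have := hu i
    rw [wire, dif_pos i.2] at this
    exact this
  · intro hu k
    by_cases hk : k < W
    · rw [wire, dif_pos hk, hu]; rfl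
    · rw [wire, dif_neg hk, initialContents, dif_neg (by omega)]

open Classical in
theorem slice_initialState {c q : ℕ} (h : c ≤ q) (χ : Bits c) (d : ℕ → Bool) :
    slice q (initialState χ) d =
      if d 0 = false ∧ ∀ k, q < k → d k = false then inputVec q 0 χ else 0 := by
  funext u
  have key : embed (· + 1) d u = initialContents χ ↔
      (d 0 = false ∧ ∀ k, q < k → d k = false) ∧
      u = fun i : Fin q => if h : 0 ≤ (i : ℕ) ∧ (i : ℕ) - 0 < c then χ ⟨(i : ℕ) - 0, h.2⟩
        else false := by
    rw [funext_iff, funext_iff]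
    constructor
    · refine fun hu => ⟨⟨?_, fun k hk => ?_⟩, fun i => ?_⟩
      · rw [← embed_succ_zero d u, hu, initialContents, dif_neg (by omega)]
      · rw [← embed_succ_of_lt d u hk, hu, initialContents, dif_neg (by omega)]
      · rw [← embed_apply addOne_injective d u i, hu]
        simp [initialContents]
    · rintro ⟨⟨h0, h1⟩, h2⟩ k
      rcases Nat.eq_zero_or_pos k with rfl | hk
      · rw [embed_succ_zero, h0, initialContents, dif_neg (by omega)]
      by_cases hkq : q < k
      · rw [embed_succ_of_lt d u hkq, h1 k hkq, initialContents, dif_neg (by omega)]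
      · obtain ⟨k, rfl⟩ : ∃ j, k = j + 1 := ⟨k - 1, by omega⟩
        have := embed_apply addOne_injective d u ⟨k, by omega⟩
        rw [h2] at this
        rw [show embed (· + 1) d u (k + 1) = _ from this]
        simp [initialContents]
  rw [slice, initialState, Pi.single_apply]
  simp only [key]
  by_cases hd : d 0 = false ∧ ∀ k, q < k → d k = false
  · rw [if_pos hd, inputVec, Pi.single_apply]
    simp only [and_iff_right hd]
  · rw [if_neg hd, if_neg (fun h => hd h.1)]; rfl

theorem slice_copyCircuit {q Q l : ℕ} (hq : q < Q) (hl : l ≤ q) (F : (ℕ → Bool) → ℂ)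
    (c : ℕ → Bool) (u : Bits q) :
    slice q (circuitAct (copyCircuit Q l) F) c u =
      slice q F (fun k => if Q ≤ k ∧ k < Q + l then xor (c k) (wire u (k - Q)) else c k) u := by
  rw [slice, circuitAct_copyCircuit (by omega), slice]
  congr 1
  funext k
  rcases Nat.eq_zero_or_pos k with rfl | hk
  · rw [if_neg (by omega), embed_succ_zero, embed_succ_zero, if_neg (by omega)]
  by_cases hkq : q < k
  · rw [embed_succ_of_lt _ u hkq, embed_succ_of_lt _ u hkq]
    split_ifs with h
    · rw [← embed_wire addOne_injective c u (show k - Q < q by omega)]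
    · rfl
  · rw [if_neg (by omega)]
    obtain ⟨k, rfl⟩ : ∃ j, k = j + 1 := ⟨k - 1, by omega⟩
    exact (embed_apply addOne_injective c u ⟨k, by omega⟩).trans
      (embed_apply addOne_injective _ u ⟨k, by omega⟩).symm

/-- All wires beyond the `q` device qubits, other than the `l` wires from `Q` on, are zero. -/
def ZeroOutside (q Q l : ℕ) (c : ℕ → Bool) : Prop :=
  ∀ k, q < k → k < Q ∨ Q + l ≤ k → c k = false

theorem zeroOutside_update_zero {q Q l : ℕ} (c : ℕ → Bool) (b : Bool) :
    ZeroOutside q Q l (Function.update c 0 b) ↔ ZeroOutside q Q l c := by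
  refine forall_congr' fun k => ?_
  by_cases hk : k = 0
  · subst hk; simp
  · rw [Function.update_of_ne hk]

namespace CompiledModel

variable {X Y : Type} {S : EncScheme X} {M : CompiledModel S Y}

-- Deferred measurement: for contents `α` of the copy register, the device is left in the
-- unnormalized post-measurement state for `α`. The first Hadamard gate contributes `1/√2` to both
-- values of the control.
open Classical in
theorem slice_first_round {n Q : ℕ} (hQ : M.q n + 2 ≤ Q) (χ : Bits (S.ctLen n)) (c : ℕ → Bool) :
    slice (M.q n) (circuitAct ([.had 0] ++ ((M.first.gates n).map (Gate.map (· + 1)) ++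
      (copyCircuit Q (S.outLen n) ++ (M.post.gates n).map (Gate.map (· + 1)))))
        (initialState χ)) c =
      if ZeroOutside (M.q n) Q (S.outLen n) c then
        (1 / (Real.sqrt 2 : ℂ)) • M.state n χ (fun j => c (Q + j)) else 0 := by
  have hl := M.outLen_le n
  rw [circuitAct_append, circuitAct_append, circuitAct_append,
    slice_circuitAct (M.post.wellFormed n)]
  set G := circuitAct [.had 0] (initialState χ) with hG
  -- The sign of the Hadamard gate never appears, because the initial control is `0`; hence there is
  -- no condition on `c 0`.
  have h1 : ∀ c, slice (M.q n) G c = if ∀ k, M.q n < k → c k = false then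
      (1 / (Real.sqrt 2 : ℂ)) • inputVec (M.q n) 0 χ else 0 := by
    intro c
    rw [hG, circuitAct, List.foldl_cons, List.foldl_nil, slice_had_zero,
      slice_initialState (M.ctLen_le n), slice_initialState (M.ctLen_le n)]
    have : (∀ k, M.q n < k → Function.update c 0 false k = false) ↔
        ∀ k, M.q n < k → c k = false := by
      refine forall_congr' fun k => imp_congr_right fun hk => ?_
      rw [Function.update_of_ne (by omega)]
    simp only [Function.update_self, true_and, this]
    split_ifs <;> simp_all
  have h2 : slice (M.q n) (circuitAct (copyCircuit Q (S.outLen n))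
      (circuitAct ((M.first.gates n).map (Gate.map (· + 1))) G)) c =
      if ZeroOutside (M.q n) Q (S.outLen n) c then (1 / (Real.sqrt 2 : ℂ)) •
        registerProj (M.q n) (fun j : Fin (S.outLen n) => c (Q + j)) *ᵥ
          (M.first.matrix n *ᵥ inputVec (M.q n) 0 χ) else 0 := by
    funext u
    rw [slice_copyCircuit (by omega) hl, slice_circuitAct (M.first.wellFormed n), h1]
    -- Before copying, the target wires were zero. A nonzero amplitude thus forces the copy to agree
    -- with the answer register, which is the effect of `registerProj`.
    have key : (∀ k, M.q n < k → (if Q ≤ k ∧ k < Q + S.outLen n then xor (c k) (wire u (k - Q))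
        else c k) = false) ↔ ZeroOutside (M.q n) Q (S.outLen n) c ∧
        ∀ j : Fin (S.outLen n), wire u j = c (Q + j) := by
      constructor
      · refine fun h => ⟨fun k hk hk' => ?_, fun j => ?_⟩
        · have := h k hk
          rwa [if_neg (by omega)] at this
        · have := h (Q + j) (by omega)
          rw [if_pos (by omega), Nat.add_sub_cancel_left] at this
          cases hx : c (Q + j) <;> cases hy : wire u j <;> simp_all
      · rintro ⟨h, h'⟩ k hk
        split_ifs with hc
        · have := h' ⟨k - Q, by omega⟩
          rw [this]
          simp [show Q + (k - Q) = k by omega]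
        · exact h k hk (by omega)
    simp only [key]
    by_cases hz : ZeroOutside (M.q n) Q (S.outLen n) c
    · simp only [hz, true_and, if_true, registerProj, Pi.smul_apply, Matrix.mulVec_diagonal]
      by_cases hw : ∀ j : Fin (S.outLen n), wire u j = c (Q + j)
      · rw [if_pos hw, if_pos hw, Matrix.mulVec_smul, one_mul]; rfl
      · rw [if_neg hw, if_neg hw, Matrix.mulVec_zero]; simp
    · simp [hz]
  rw [h2]
  split_ifs
  · rw [Matrix.mulVec_smul]; rfl
  · rw [Matrix.mulVec_zero]

-- At control `1` the last Hadamard gate subtracts the branch carrying the phase and the word from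
-- the idle branch; the two factors `1/√2` give `1/2`.
open Classical in
theorem slice_hadamardTest (hM : M.IsProjective) {Q : Polynomial ℕ} {n : ℕ}
    (hQ : M.q n + 2 ≤ Q.eval n) (hQ' : ∀ _ : Y, M.q n + M.anc n + 2 ≤ Q.eval n) (k : ℕ)
    (w : List Y) (χ : Bits (S.ctLen n)) (c : ℕ → Bool) (hc : c 0 = true) :
    slice (M.q n) (circuitAct (M.hadamardTest Q k w n) (initialState χ)) c =
      if ZeroOutside (M.q n) (Q.eval n) (S.outLen n) c then
        (1 / 2 : ℂ) • (M.state n χ (fun j => c (Q.eval n + j)) -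
          Complex.exp (Complex.I * (Real.pi : ℂ) / 4) ^ k •
            M.bobOp n w *ᵥ M.state n χ (fun j => c (Q.eval n + j))) else 0 := by
  have e : M.hadamardTest Q k w n = ([.had 0] ++ ((M.first.gates n).map (Gate.map (· + 1)) ++
      (copyCircuit (Q.eval n) (S.outLen n) ++ (M.post.gates n).map (Gate.map (· + 1))))) ++
      (List.replicate k (.tee 0) ++ (M.controlledWord n w ++ [.had 0])) := by
    simp [hadamardTest]
  rw [e, circuitAct_append, circuitAct_append, circuitAct_append]
  have h1 := slice_first_round hQ χ
  generalize circuitAct ([.had 0] ++ ((M.first.gates n).map (Gate.map (· + 1)) ++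
      (copyCircuit (Q.eval n) (S.outLen n) ++ (M.post.gates n).map (Gate.map (· + 1)))))
        (initialState χ) = F at *
  have h2 := slice_tee_zero (M.q n) k F
  generalize circuitAct (List.replicate k (.tee 0)) F = G at *
  have hG : ZeroBetween (M.q n) (Q.eval n) G := by
    rintro s ⟨k, a1, a2, a3⟩
    have hz : ¬ ZeroOutside (M.q n) (Q.eval n) (S.outLen n) s := fun h => by
      simp [h k a1 (.inl a2)] at a3
    rw [← slice_self (M.q n) G s, h2, h1, if_neg hz, smul_zero]
    rfl
  have h3 := (slice_controlledWord hM hQ' w hG).2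
  generalize circuitAct (M.controlledWord n w) G = H at *
  rw [circuitAct, List.foldl_cons, List.foldl_nil, slice_had_zero]
  have hu : ∀ b, (fun j : Fin (S.outLen n) => Function.update c 0 b (Q.eval n + j)) =
      fun j : Fin (S.outLen n) => c (Q.eval n + j) := by
    intro b
    funext j
    rw [Function.update_of_ne (by omega)]
  simp only [h3, h2, h1, Function.update_self, zeroOutside_update_zero, hc, hu,
    Bool.false_eq_true, if_true, if_false, one_smul]
  split_ifs
  · have hs : (1 / (Real.sqrt 2 : ℂ)) * (1 / (Real.sqrt 2 : ℂ)) = 1 / 2 := by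
      rw [div_mul_div_comm, sqrt_two_mul_self, one_mul]
    rw [Matrix.mulVec_smul, Matrix.mulVec_smul]
    funext u
    simp only [Pi.smul_apply, Pi.add_apply, Pi.sub_apply, smul_eq_mul]
    linear_combination (M.state n χ (fun j => c (Q.eval n + j)) u -
      Complex.exp (Complex.I * (Real.pi : ℂ) / 4) ^ k *
        (M.bobOp n w *ᵥ M.state n χ (fun j => c (Q.eval n + j))) u) * hs
  · simp

end CompiledModel

/-! ### The acceptance probability of the Hadamard test -/

-- Accepting basis states that satisfy the support condition correspond to pairs of an encrypted
-- answer and device contents, every other wire being forced to zero.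
open Classical in
theorem sum_zeroOutside {q Q l W : ℕ} (hq : q < Q) (hW : Q + l ≤ W)
    (f : Bits l → Bits q → ℝ) :
    ∑ s : Bits W, (if wire s 0 = true ∧ ZeroOutside q Q l (wire s) then
      f (fun j => wire s (Q + j)) (fun i => wire s (i + 1)) else 0) =
      ∑ α : Bits l, ∑ u : Bits q, f α u := by
  rw [← Finset.sum_filter, ← Fintype.sum_prod_type']
  refine Finset.sum_nbij' (fun s => (fun j => wire s (Q + j), fun i => wire s (i + 1)))
    (fun p k => if (k : ℕ) = 0 then true else if (k : ℕ) ≤ q then wire p.2 (k - 1)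
      else if Q ≤ (k : ℕ) then wire p.1 (k - Q) else false) (by simp) ?_ ?_ ?_ ?_
  · intro p _
    simp only [Finset.mem_filter, Finset.mem_univ, true_and]
    refine ⟨by rw [wire, dif_pos (by omega)]; simp, fun k hk hk' => ?_⟩
    by_cases hkW : k < W
    · rw [wire, dif_pos hkW]
      dsimp only
      rw [if_neg (by omega), if_neg (by omega)]
      split_ifs
      · rw [wire, dif_neg (by omega)]
      · rfl
    · rw [wire, dif_neg hkW]
  · intro s hs
    simp only [Finset.mem_filter, Finset.mem_univ, true_and] at hs
    obtain ⟨h0, h1⟩ := hs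
    funext k
    have hk : wire s k = s k := by rw [wire, dif_pos k.2]
    rw [← hk]
    dsimp only
    split_ifs with a b c
    · rw [a, h0]
    · rw [wire, dif_pos (by omega), show (k : ℕ) - 1 + 1 = k by omega]
    · by_cases d : (k : ℕ) - Q < l
      · rw [wire, dif_pos d, show Q + (k - Q) = (k : ℕ) by omega]
      · rw [wire, dif_neg d, h1 k (by omega) (by omega)]
    · rw [h1 k (by omega) (by omega)]
  · rintro ⟨α, u⟩ _
    ext i
    · dsimp only
      rw [wire, dif_pos (by omega)]
      dsimp only
      rw [if_neg (by omega), if_neg (by omega), if_pos (by omega), Nat.add_sub_cancel_left, wire,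
        dif_pos i.2]
    · dsimp only
      rw [wire, dif_pos (by omega)]
      dsimp only
      rw [if_neg (by omega), if_pos (by omega), Nat.add_sub_cancel, wire, dif_pos i.2]
  · simp

theorem embed_id_zero {W : ℕ} (s : Bits W) : embed id (fun _ => false) s = wire s := by
  funext k
  by_cases hk : k < W
  · exact embed_wire Function.injective_id _ s hk
  · rw [wire, dif_neg hk]
    exact Function.extend_apply' _ _ _ fun ⟨i, hi⟩ => hk (hi ▸ i.2)

/-- This links the formal semantics of a distinguisher, on finitely many wires, with the calculus on
infinitely many. -/
theorem circuitMatrix_mulVec_inputVec {c W : ℕ} (h : c + 1 ≤ W) {C : List Gate}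
    (hC : ∀ g ∈ C, g.WellFormed W) (χ : Bits c) (s : Bits W) :
    (circuitMatrix W C *ᵥ inputVec W 1 χ) s = circuitAct C (initialState χ) (wire s) := by
  have h1 := circuitAct_map Function.injective_id hC (initialState χ) (fun _ => false)
  have h2 : Gate.map id = id := funext fun g => by cases g <;> rfl
  simp only [h2, List.map_id, embed_id_zero, initialState_wire h] at h1
  exact (congrFun h1 s).symm

/-- Expanding the square, both diagonal terms equal `‖v‖²` because `T` is an isometry, so only the
cross term carries information about `T`. -/
theorem sum_norm_sq_sub_smul {ι : Type*} [Fintype ι] [DecidableEq ι] {T : Matrix ι ι ℂ}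
    (hT : Tᴴ * T = 1) {z : ℂ} (hz : ‖z‖ = 1) (v : ι → ℂ) :
    ∑ i, ‖((1 / 2 : ℂ) • (v - z • T *ᵥ v)) i‖ ^ 2 =
      (∑ i, ‖v i‖ ^ 2) / 2 - (z * (star v ⬝ᵥ (T *ᵥ v))).re / 2 := by
  have h : ∀ i, ‖((1 / 2 : ℂ) • (v - z • T *ᵥ v)) i‖ ^ 2 =
      (‖v i‖ ^ 2 + ‖(T *ᵥ v) i‖ ^ 2) / 4 - (z * (star (v i) * (T *ᵥ v) i)).re / 2 := by
    intro i
    simp only [Pi.smul_apply, Pi.sub_apply, smul_eq_mul, norm_mul, mul_pow]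
    have e : ‖v i - z * (T *ᵥ v) i‖ ^ 2 = ‖v i‖ ^ 2 + ‖(T *ᵥ v) i‖ ^ 2 -
        2 * (z * (star (v i) * (T *ᵥ v) i)).re := by
      have hw : ‖(T *ᵥ v) i‖ ^ 2 = ‖z * (T *ᵥ v) i‖ ^ 2 := by rw [norm_mul, hz, one_mul]
      rw [hw, mul_left_comm]
      simp only [← Complex.normSq_eq_norm_sq, Complex.normSq_apply, Complex.star_def,
        Complex.mul_re, Complex.sub_re, Complex.sub_im, Complex.conj_re, Complex.conj_im]
      ring
    rw [e]
    norm_num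
    ring
  simp only [h, Finset.sum_sub_distrib, ← Finset.sum_div, Finset.sum_add_distrib,
    sum_norm_sq_mulVec hT, ← Complex.re_sum, ← Finset.mul_sum]
  simp only [dotProduct, Pi.star_apply]
  ring

theorem PMF.sum_toReal {α : Type*} [Fintype α] (p : PMF α) : ∑ a, (p a).toReal = 1 := by
  have h := p.tsum_coe
  rw [tsum_fintype] at h
  rw [← ENNReal.toReal_sum (fun a _ => p.apply_ne_top a), h, ENNReal.toReal_one]

theorem sum_registerProj {q l : ℕ} (v : Bits q → ℂ) :
    ∑ α : Bits l, ∑ s, ‖(registerProj q α *ᵥ v) s‖ ^ 2 = ∑ s, ‖v s‖ ^ 2 := by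
  rw [Finset.sum_comm]
  refine Finset.sum_congr rfl fun s _ => ?_
  simp only [registerProj, Matrix.mulVec_diagonal]
  rw [Finset.sum_eq_single (fun j : Fin l => wire s j)]
  · simp
  · intro α _ hα
    rw [if_neg fun h => hα (funext fun j => (h j).symm)]
    simp
  · simp

namespace CompiledModel

variable {X Y : Type} {S : EncScheme X} {M : CompiledModel S Y}

theorem sum_norm_sq_state (M : CompiledModel S Y) (n : ℕ) (χ : Bits (S.ctLen n)) :
    ∑ α : Bits (S.outLen n), ∑ u, ‖M.state n χ α u‖ ^ 2 = 1 := by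
  simp only [state, sum_norm_sq_mulVec (M.post.conjTranspose_matrix_mul n)]
  rw [sum_registerProj, sum_norm_sq_mulVec (M.first.conjTranspose_matrix_mul n), inputVec]
  rw [Finset.sum_eq_single_of_mem _ (Finset.mem_univ _) fun s _ hs => by
    rw [Pi.single_eq_of_ne hs]; simp]
  rw [Pi.single_eq_same]
  simp

/-- Different encrypted answers occupy orthogonal copy registers, so their contributions add without
interference; the norms of the post-measurement states sum to one and give the term `1/2`. -/
theorem accept_hadamardTest (hM : M.IsProjective) {Q : Polynomial ℕ} {n : ℕ}
    (hQ : M.q n + 2 ≤ Q.eval n) (hQ' : ∀ _ : Y, M.q n + M.anc n + 2 ≤ Q.eval n) (k : ℕ)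
    (w : List Y) (χ : Bits (S.ctLen n)) :
    (∑ s : Bits (Q.eval n + Q.eval n), if wire s 0 = true then
      ‖(circuitMatrix _ (M.hadamardTest Q k w n) *ᵥ inputVec _ 1 χ) s‖ ^ 2 else 0) =
    1 / 2 - (Complex.exp (Complex.I * (Real.pi : ℂ) / 4) ^ k *
      ∑ α, star (M.state n χ α) ⬝ᵥ (M.bobOp n w *ᵥ M.state n χ α)).re / 2 := by
  classical
  have hl := M.outLen_le n
  have hc := M.ctLen_le n
  have hz : ‖Complex.exp (Complex.I * (Real.pi : ℂ) / 4) ^ k‖ = 1 := by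
    rw [norm_pow, Complex.norm_exp]; simp
  set z := Complex.exp (Complex.I * (Real.pi : ℂ) / 4) ^ k with hzdef
  have h1 := sum_zeroOutside (q := M.q n) (Q := Q.eval n) (l := S.outLen n)
    (W := Q.eval n + Q.eval n) (by omega) (by omega)
    (fun α u => ‖((1 / 2 : ℂ) • (M.state n χ α - z • M.bobOp n w *ᵥ M.state n χ α)) u‖ ^ 2)
  simp only [sum_norm_sq_sub_smul (bobOp_isometry hM n w) hz, Finset.sum_sub_distrib,
    ← Finset.sum_div, sum_norm_sq_state, ← Complex.re_sum, ← Finset.mul_sum] at h1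
  rw [← h1]
  refine Finset.sum_congr rfl fun s _ => ?_
  rw [circuitMatrix_mulVec_inputVec (by omega) (M.wellFormed_hadamardTest hQ hQ' k w)]
  by_cases h0 : wire s 0 = true
  · rw [if_pos h0, ← slice_self (M.q n) (circuitAct (M.hadamardTest Q k w n) (initialState χ)),
      slice_hadamardTest hM hQ hQ' k w χ _ h0]
    simp only [h0, true_and]
    split_ifs
    · rfl
    · simp
  · rw [if_neg h0, if_neg fun h => h0 h.1]

theorem acceptProb_distinguisher (hM : M.IsProjective) {Q : Polynomial ℕ}
    (hQ : ∀ n, M.q n + 2 ≤ Q.eval n) (hQ' : ∀ n, ∀ _ : Y, M.q n + M.anc n + 2 ≤ Q.eval n)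
    (k : ℕ) (w : List Y) (n : ℕ) (x : X) :
    S.acceptProb (M.distinguisher Q hQ hQ' k w) n x =
      1 / 2 - (Complex.exp (Complex.I * (Real.pi : ℂ) / 4) ^ k *
        M.expect n x (fun _ => 1) (M.bobOp n w)).re / 2 := by
  have h := accept_hadamardTest hM (hQ n) (hQ' n) k w
  rw [EncScheme.acceptProb]
  simp only [QPTCircuits.matrix, distinguisher, h, expect, one_mul]
  set z := Complex.exp (Complex.I * (Real.pi : ℂ) / 4) ^ k with hzdef
  have hre : ∀ (r : ℝ) (c : ℂ), r * (z * c).re = (z * (r * c)).re := by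
    intro r c
    rw [mul_left_comm, Complex.re_ofReal_mul]
  simp only [mul_sub, Finset.sum_sub_distrib, ← Finset.sum_mul, PMF.sum_toReal, one_mul]
  simp only [mul_div_assoc', hre, ← Finset.sum_div, ← Complex.re_sum, ← Finset.mul_sum]

theorem expect_one (M : CompiledModel S Y) (n : ℕ) (x : X) :
    M.expect n x (fun _ => 1) 1 = 1 := by
  have h : ∀ χ, ∑ α, star (M.state n χ α) ⬝ᵥ M.state n χ α = 1 := by
    intro χ
    simp only [star_dotProduct_self]
    rw [← Complex.ofReal_sum, sum_norm_sq_state, Complex.ofReal_one]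
  simp only [expect, Matrix.one_mulVec, one_mul, h, mul_one, ← Complex.ofReal_sum,
    PMF.sum_toReal, Complex.ofReal_one]

end CompiledModel

/-! ### Negligible functions -/

theorem Negligible.zero : Negligible fun _ => 0 := fun k => ⟨0, fun n _ => by positivity⟩

/-- Using the bounds for exponent `k + 1` leaves a spare factor `1/n`, which absorbs the `2` once `n
≥ 2`. -/
theorem Negligible.add {ε δ : ℕ → ℝ} (hε : Negligible ε) (hδ : Negligible δ) :
    Negligible fun n => ε n + δ n := by
  intro k
  obtain ⟨N, hN⟩ := hε (k + 1)
  obtain ⟨N', hN'⟩ := hδ (k + 1)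
  refine ⟨max (max N N') 2, fun n hn => ?_⟩
  simp only [ge_iff_le, max_le_iff] at hn
  have h2 : (2 : ℝ) ≤ n := by exact_mod_cast hn.2
  have hp : (0 : ℝ) < (n : ℝ) ^ k := by positivity
  calc ε n + δ n ≤ 1 / (n : ℝ) ^ (k + 1) + 1 / (n : ℝ) ^ (k + 1) :=
        add_le_add (hN n hn.1.1) (hN' n hn.1.2)
    _ = 2 / n * (1 / (n : ℝ) ^ k) := by rw [pow_succ]; field_simp; norm_num
    _ ≤ 1 * (1 / (n : ℝ) ^ k) := by
        gcongr
        rw [div_le_one (by linarith)]; exact h2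
    _ = _ := one_mul _

theorem Negligible.const_mul {ε : ℕ → ℝ} (hε : Negligible ε) {c : ℝ} (hc : 0 ≤ c) :
    Negligible fun n => c * ε n := by
  intro k
  obtain ⟨N, hN⟩ := hε (k + 1)
  obtain ⟨N', hN'⟩ := exists_nat_ge c
  refine ⟨max (max N N') 1, fun n hn => ?_⟩
  simp only [ge_iff_le, max_le_iff] at hn
  have h1 : (1 : ℝ) ≤ n := by exact_mod_cast hn.2
  have h2 : c ≤ n := hN'.trans (by exact_mod_cast hn.1.2)
  calc c * ε n ≤ c * (1 / (n : ℝ) ^ (k + 1)) := by gcongr; exact hN n hn.1.1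
    _ = c / n * (1 / (n : ℝ) ^ k) := by rw [pow_succ]; field_simp
    _ ≤ 1 * (1 / (n : ℝ) ^ k) := by
        gcongr
        rw [div_le_one (by linarith)]; exact h2
    _ = _ := one_mul _

theorem Negligible.sum {ι : Type*} (s : Finset ι) {ε : ι → ℕ → ℝ} (h : ∀ i, Negligible (ε i)) :
    Negligible fun n => ∑ i ∈ s, ε i n := by
  classical
  induction s using Finset.induction_on with
  | empty => simpa using Negligible.zero
  | insert a s ha ih => simpa only [Finset.sum_insert ha] using (h a).add ih

namespace CompiledModel

variable {X Y : Type} {S : EncScheme X} {M : CompiledModel S Y}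

theorem exists_width_bound (M : CompiledModel S Y) : ∃ Q : Polynomial ℕ,
    (∀ n, M.q n + 2 ≤ Q.eval n) ∧ ∀ n, ∀ _ : Y, M.q n + M.anc n + 2 ≤ Q.eval n := by
  obtain ⟨p, hp⟩ := M.first.width_poly
  have hp : ∀ n, M.q n ≤ p.eval n := hp
  -- If there is no question `y`, no circuit bounds `anc`; this is why the second requirement is
  -- quantified over `Y`.
  rcases isEmpty_or_nonempty Y with h | ⟨⟨y⟩⟩
  · exact ⟨p + Polynomial.C 2, fun n => by simpa using hp n, fun n y => h.elim y⟩
  · obtain ⟨r, hr⟩ := (M.second y).width_poly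
    have hr : ∀ n, M.q n + M.anc n ≤ r.eval n := hr
    refine ⟨r + Polynomial.C 2, fun n => ?_, fun n _ => ?_⟩ <;>
    · have := hr n
      simp only [Polynomial.eval_add, Polynomial.eval_C]
      omega

/-- The expectation of a monomial in Bob's observables depends on the encrypted question only
negligibly. -/
theorem expect_bobOp_indistinguishable (hS : S.Secure) (hM : M.IsProjective) (w : List Y)
    (x₀ x₁ : X) : ∃ ε : ℕ → ℝ, Negligible ε ∧ ∀ n,
      ‖M.expect n x₀ (fun _ => 1) (M.bobOp n w) - M.expect n x₁ (fun _ => 1) (M.bobOp n w)‖ ≤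
        ε n := by
  obtain ⟨Q, hQ, hQ'⟩ := M.exists_width_bound
  have hW : ∀ n, S.ctLen n + 1 ≤ Q.eval n + Q.eval n := fun n => by
    have := M.ctLen_le n
    have := hQ n
    omega
  -- Without a phase the test sees the real part of the expectation; with `T²`, the phase `i`, it
  -- sees minus the imaginary part.
  obtain ⟨ε, hε, h⟩ := hS x₀ x₁ _ (M.distinguisher Q hQ hQ' 0 w) hW
  obtain ⟨δ, hδ, h'⟩ := hS x₀ x₁ _ (M.distinguisher Q hQ hQ' 2 w) hW
  refine ⟨_, (hε.add hδ).const_mul zero_le_two, fun n => ?_⟩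
  have h := h n
  have h' := h' n
  simp only [acceptProb_distinguisher hM] at h h'
  have hi : Complex.exp (Complex.I * (Real.pi : ℂ) / 4) ^ 2 = Complex.I := by
    rw [← Complex.exp_nat_mul]
    refine Eq.trans ?_ Complex.exp_pi_div_two_mul_I
    congr 1
    push_cast
    ring
  rw [hi] at h'
  simp only [pow_zero, one_mul, Complex.I_mul_re] at h h'
  refine (Complex.norm_le_abs_re_add_abs_im _).trans ?_
  rw [Complex.sub_re, Complex.sub_im]
  rw [abs_le] at h h'
  -- The factor `2` undoes the `1/2` in front of the expectation in the acceptance probability.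
  have a1 : |(M.expect n x₀ (fun _ => 1) (M.bobOp n w)).re -
      (M.expect n x₁ (fun _ => 1) (M.bobOp n w)).re| ≤ 2 * ε n := by
    rw [abs_le]; constructor <;> linarith
  have a2 : |(M.expect n x₀ (fun _ => 1) (M.bobOp n w)).im -
      (M.expect n x₁ (fun _ => 1) (M.bobOp n w)).im| ≤ 2 * δ n := by
    rw [abs_le]; constructor <;> linarith
  linarith

end CompiledModel

/-! ### Expectations as linear functionals -/

theorem bobReduce_cons {Y : Type} [DecidableEq Y] (y : Y) (w : List Y) :
    bobReduce (y :: w) = if (bobReduce w).head? = some y then (bobReduce w).tail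
      else y :: bobReduce w := rfl

theorem sgn_pow {m : ℕ} (a : Bool) : sgn a ^ m = if Even m then 1 else sgn a := by
  cases a
  · simp [sgn]
  · split_ifs with h
    · simp [sgn, h.neg_one_pow]
    · simp [sgn, (Nat.not_even_iff_odd.mp h).neg_one_pow]

theorem star_sgn (a : Bool) : star (sgn a) = sgn a := by cases a <;> simp [sgn]

namespace CompiledModel

variable {X Y : Type} {S : EncScheme X} {M : CompiledModel S Y}

theorem bobOp_bobReduce [DecidableEq Y] (hM : M.IsProjective) (n : ℕ) (w : List Y) :
    M.bobOp n (bobReduce w) = M.bobOp n w := by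
  induction w with
  | nil => rfl
  | cons y w ih =>
    have h : M.bobOp n (y :: w) = M.bobObs n y * M.bobOp n (bobReduce w) := by
      rw [ih]; simp [bobOp]
    rw [h, bobReduce_cons]
    split_ifs with hy
    · cases hr : bobReduce w with
      | nil => simp [hr] at hy
      | cons z r =>
        rw [hr, List.head?_cons, Option.some.injEq] at hy
        subst hy
        simp only [List.tail_cons, bobOp, List.map_cons, List.prod_cons]
        rw [← Matrix.mul_assoc, bobObs_mul_self hM, Matrix.one_mul]
    · simp [bobOp]

/-- The expectation of an operator that may depend on the decrypted answer. -/
def expectLin (M : CompiledModel S Y) (n : ℕ) (x : X) :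
    (Bool → Matrix (Bits (M.q n)) (Bits (M.q n)) ℂ) →ₗ[ℂ] ℂ where
  toFun g := ∑ sk : Bits (S.keyLen n), ((S.gen n sk).toReal : ℂ) *
    ∑ χ : Bits (S.ctLen n), ((S.enc n sk x χ).toReal : ℂ) *
      ∑ α : Bits (S.outLen n), star (M.state n χ α) ⬝ᵥ (g (S.dec n sk α) *ᵥ M.state n χ α)
  map_add' g h := by
    simp only [Pi.add_apply, Matrix.add_mulVec, dotProduct_add, Finset.sum_add_distrib, mul_add]
  map_smul' c g := by
    simp only [Pi.smul_apply, Matrix.smul_mulVec, dotProduct_smul, ← Finset.smul_sum,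
      mul_smul_comm, RingHom.id_apply]

theorem expect_eq_expectLin (M : CompiledModel S Y) (n : ℕ) (x : X) (f : Bool → ℂ)
    (T : Matrix (Bits (M.q n)) (Bits (M.q n)) ℂ) :
    M.expect n x f T = M.expectLin n x fun a => f a • T := by
  simp only [expect, expectLin, LinearMap.coe_mk, AddHom.coe_mk, Matrix.smul_mulVec,
    dotProduct_smul, smul_eq_mul]

theorem star_expectLin (n : ℕ) (x : X)
    (g : Bool → Matrix (Bits (M.q n)) (Bits (M.q n)) ℂ) :
    star (M.expectLin n x g) = M.expectLin n x fun a => (g a)ᴴ := by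
  have h : ∀ (T : Matrix (Bits (M.q n)) (Bits (M.q n)) ℂ) (v : Bits (M.q n) → ℂ),
      star (star v ⬝ᵥ (T *ᵥ v)) = star v ⬝ᵥ (Tᴴ *ᵥ v) := by
    intro T v
    rw [Matrix.star_dotProduct, star_star, Matrix.star_mulVec,
      ← Matrix.dotProduct_mulVec]
  simp only [expectLin, LinearMap.coe_mk, AddHom.coe_mk, star_sum, star_mul', h]
  simp only [Complex.star_def, Complex.conj_ofReal]

theorem expectLin_nonneg (n : ℕ) (x : X)
    (g : Bool → Matrix (Bits (M.q n)) (Bits (M.q n)) ℂ) :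
    0 ≤ (M.expectLin n x fun a => (g a)ᴴ * g a).re := by
  simp only [expectLin, LinearMap.coe_mk, AddHom.coe_mk, ← star_mulVec_dotProduct,
    star_dotProduct_self, ← Complex.ofReal_sum, ← Complex.ofReal_mul, Complex.ofReal_re]
  positivity

/-- The expectation of an operator of Bob, averaged over the encrypted question. -/
def averageExp [Fintype X] (M : CompiledModel S Y) (μ : PMF X) (n : ℕ)
    (T : Matrix (Bits (M.q n)) (Bits (M.q n)) ℂ) : ℂ :=
  ∑ x, ((μ x).toReal : ℂ) * M.expect n x (fun _ => 1) T

theorem sum_pmf_complex {α : Type*} [Fintype α] (p : PMF α) : ∑ a, ((p a).toReal : ℂ) = 1 := by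
  rw [← Complex.ofReal_sum, PMF.sum_toReal, Complex.ofReal_one]

theorem star_averageExp [Fintype X] (μ : PMF X) (n : ℕ)
    (T : Matrix (Bits (M.q n)) (Bits (M.q n)) ℂ) :
    star (M.averageExp μ n T) = M.averageExp μ n Tᴴ := by
  simp only [averageExp, star_sum, star_mul', expect_eq_expectLin, star_expectLin, one_smul]
  simp only [Complex.star_def, Complex.conj_ofReal]

theorem averageExp_one [Fintype X] (μ : PMF X) (n : ℕ) : M.averageExp μ n 1 = 1 := by
  simp only [averageExp, expect_one, mul_one, sum_pmf_complex]

/-- The weights sum to one, so the constant term can be moved inside the average; each weight is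
then bounded by one. -/
theorem norm_averageExp_sub_le [Fintype X] (μ : PMF X) (n : ℕ) (x : X)
    (T : Matrix (Bits (M.q n)) (Bits (M.q n)) ℂ) :
    ‖M.averageExp μ n T - M.expect n x (fun _ => 1) T‖ ≤
      ∑ x', ‖M.expect n x' (fun _ => 1) T - M.expect n x (fun _ => 1) T‖ := by
  have h : M.averageExp μ n T - M.expect n x (fun _ => 1) T = ∑ x', ((μ x').toReal : ℂ) *
      (M.expect n x' (fun _ => 1) T - M.expect n x (fun _ => 1) T) := by
    simp only [mul_sub, Finset.sum_sub_distrib, ← Finset.sum_mul, sum_pmf_complex, one_mul,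
      averageExp]
  rw [h]
  refine (norm_sum_le _ _).trans (Finset.sum_le_sum fun x' _ => ?_)
  rw [norm_mul, Complex.norm_real, Real.norm_of_nonneg ENNReal.toReal_nonneg]
  refine mul_le_of_le_one_left (norm_nonneg _) ?_
  exact ENNReal.toReal_le_of_le_ofReal zero_le_one (by simpa using μ.coe_le_one x')

theorem averageExp_indistinguishable [Fintype X] (hS : S.Secure) (hM : M.IsProjective) (μ : PMF X)
    (w : List Y) (x : X) : ∃ ε : ℕ → ℝ, Negligible ε ∧ ∀ n,
      ‖M.averageExp μ n (M.bobOp n w) - M.expect n x (fun _ => 1) (M.bobOp n w)‖ ≤ ε n := by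
  choose ε hε h using fun x' => expect_bobOp_indistinguishable hS hM w x' x
  exact ⟨_, Negligible.sum Finset.univ hε, fun n => (norm_averageExp_sub_le μ n x _).trans
    (Finset.sum_le_sum fun x' _ => h x' n)⟩

/-! ### The pseudo-expectation of a monomial -/

theorem pseudoExp_single [Fintype X] [DecidableEq X] [DecidableEq Y] (μ : PMF X) (n : ℕ)
    (w : FreeMonoid (Obs X Y)) (c : ℂ) :
    M.pseudoExp μ n (MonoidAlgebra.single w c) = c * M.pseudoExpMonomial μ n w := by
  simp [pseudoExp]

/-- The positions of the letters `A_x` do not matter, and reducing Bob's word does not change its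
operator. For `m = 0` the setting `x` is arbitrary, which lets words without Alice's letters be
treated uniformly. -/
theorem pseudoExpMonomial_eq [Fintype X] [DecidableEq X] [DecidableEq Y] (hM : M.IsProjective)
    (μ : PMF X) (n : ℕ) {w : FreeMonoid (Obs X Y)} {x : X} {m : ℕ} {v : List Y}
    (ha : aliceLetters w = List.replicate m x) (hb : bobLetters w = v) :
    M.pseudoExpMonomial μ n w =
      if Even m then M.averageExp μ n (M.bobOp n v) else M.expect n x sgn (M.bobOp n v) := by
  subst hb
  rw [pseudoExpMonomial, ha, bobOp_bobReduce hM]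
  cases m with
  | zero => simp [averageExp]
  | succ m =>
    rw [List.replicate_succ]
    dsimp only
    rw [if_pos fun x' hx' => List.eq_of_mem_replicate hx']
    simp only [List.length_cons, List.length_replicate]
    rfl

end CompiledModel

/-! ### Words and polynomials -/

theorem aliceLetters_mul {X Y : Type} (v w : FreeMonoid (Obs X Y)) :
    aliceLetters (v * w) = aliceLetters v ++ aliceLetters w := by
  simp [aliceLetters]

theorem bobLetters_mul {X Y : Type} (v w : FreeMonoid (Obs X Y)) :
    bobLetters (v * w) = bobLetters v ++ bobLetters w := by
  simp [bobLetters]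

theorem aliceLetters_star {X Y : Type} (w : FreeMonoid (Obs X Y)) :
    aliceLetters (star w) = (aliceLetters w).reverse :=
  List.filterMap_reverse

theorem bobLetters_star {X Y : Type} (w : FreeMonoid (Obs X Y)) :
    bobLetters (star w) = (bobLetters w).reverse :=
  List.filterMap_reverse

/-- The word `(A_x)^k w(B)`. -/
def obsWord {X Y : Type} (x : X) (k : ℕ) (w : List Y) : FreeMonoid (Obs X Y) :=
  FreeMonoid.ofList (List.replicate k (.alice x) ++ w.map .bob)

theorem aliceLetters_obsWord {X Y : Type} (x : X) (k : ℕ) (w : List Y) :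
    aliceLetters (obsWord x k w) = List.replicate k x := by
  simp [aliceLetters, obsWord, List.filterMap_append, List.filterMap_map]

theorem bobLetters_obsWord {X Y : Type} (x : X) (k : ℕ) (w : List Y) :
    bobLetters (obsWord x k w) = w := by
  simp [bobLetters, obsWord, List.filterMap_append, List.filterMap_map]

namespace ObsPoly

variable {X Y : Type}

theorem A_pow_mul_bobMonomial (x : X) (k : ℕ) (w : List Y) :
    A x ^ k * bobMonomial w = MonoidAlgebra.single (obsWord x k w) 1 := by
  have hB : (bobMonomial w : ObsPoly X Y) =
      MonoidAlgebra.single (FreeMonoid.ofList (w.map .bob)) 1 := by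
    induction w with
    | nil => rfl
    | cons y w ih =>
      rw [bobMonomial, List.map_cons, List.prod_cons, ← bobMonomial, ih, B,
        MonoidAlgebra.single_mul_single, one_mul]
      rfl
  rw [hB]
  induction k with
  | zero => simp [obsWord]
  | succ k ih =>
    rw [pow_succ', mul_assoc, ih, A, MonoidAlgebra.single_mul_single, one_mul]
    rfl

theorem dagger_single (w : FreeMonoid (Obs X Y)) (c : ℂ) :
    dagger (MonoidAlgebra.single w c) = MonoidAlgebra.single (star w) (star c) := by
  simp [dagger]

theorem dagger_add (P Q : ObsPoly X Y) : dagger (P + Q) = dagger P + dagger Q := by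
  rw [dagger, MonoidAlgebra.coeff_add,
    Finsupp.sum_add_index' (by simp) (by simp [MonoidAlgebra.single_add])]
  rfl

theorem dagger_sum {ι : Type*} (s : Finset ι) (P : ι → ObsPoly X Y) :
    dagger (∑ i ∈ s, P i) = ∑ i ∈ s, dagger (P i) :=
  map_sum (⟨⟨dagger, by simp [dagger]⟩, dagger_add⟩ : ObsPoly X Y →+ ObsPoly X Y) P s

end ObsPoly

namespace CompiledModel

variable {X Y : Type} {S : EncScheme X} {M : CompiledModel S Y}

/-! ### Approximate positivity -/

/-- The value of the pseudo-expectation on `(A_x)^m T` for an operator `T` of Bob. -/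
def parityExp [Fintype X] (M : CompiledModel S Y) (μ : PMF X) (n : ℕ) (x : X) (m : ℕ)
    (T : Matrix (Bits (M.q n)) (Bits (M.q n)) ℂ) : ℂ :=
  if Even m then M.averageExp μ n T else M.expect n x sgn T

theorem star_parityExp [Fintype X] (μ : PMF X) (n : ℕ) (x : X) (m : ℕ)
    (T : Matrix (Bits (M.q n)) (Bits (M.q n)) ℂ) :
    star (M.parityExp μ n x m T) = M.parityExp μ n x m Tᴴ := by
  rw [parityExp, parityExp]
  split_ifs
  · exact star_averageExp μ n T
  · simp only [expect_eq_expectLin, star_expectLin, Matrix.conjTranspose_smul, star_sgn]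

theorem pseudoExp_square [Fintype X] [DecidableEq X] [DecidableEq Y] (hM : M.IsProjective)
    (μ : PMF X) (n : ℕ) (x : X) {m : ℕ} (γ : Fin m → ℂ) (k : Fin m → Fin 2) (w : Fin m → List Y)
    {P : ObsPoly X Y} (hP : P = ∑ i, γ i • (ObsPoly.A x ^ (k i : ℕ) * ObsPoly.bobMonomial (w i))) :
    M.pseudoExp μ n (P.dagger * P) = ∑ i, ∑ j, star (γ i) * γ j *
      M.parityExp μ n x (k i + k j) ((M.bobOp n (w i))ᴴ * M.bobOp n (w j)) := by
  simp only [ObsPoly.A_pow_mul_bobMonomial, MonoidAlgebra.smul_single, smul_eq_mul, mul_one] at hP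
  rw [hP, ObsPoly.dagger_sum, Finset.sum_mul, map_sum]
  refine Finset.sum_congr rfl fun i _ => ?_
  rw [Finset.mul_sum, map_sum]
  refine Finset.sum_congr rfl fun j _ => ?_
  rw [ObsPoly.dagger_single, MonoidAlgebra.single_mul_single, pseudoExp_single,
    pseudoExpMonomial_eq hM μ n (x := x) (m := k i + k j) (v := (w i).reverse ++ w j)]
  · rw [parityExp, bobOp_conjTranspose hM]
    simp [bobOp]
  · simp [aliceLetters_mul, aliceLetters_star, aliceLetters_obsWord]
  · simp [bobLetters_mul, bobLetters_star, bobLetters_obsWord]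

/-- Realness is exact because the pseudo-expectation is Hermitian: conjugation exchanges the
summation indices. -/
theorem im_square_eq_zero [Fintype X] (μ : PMF X) (n : ℕ) (x : X) {m : ℕ} (γ : Fin m → ℂ)
    (k : Fin m → Fin 2) (W : Fin m → Matrix (Bits (M.q n)) (Bits (M.q n)) ℂ) :
    (∑ i, ∑ j, star (γ i) * γ j * M.parityExp μ n x (k i + k j) ((W i)ᴴ * W j)).im = 0 := by
  rw [← Complex.conj_eq_iff_im, ← Complex.star_def]
  simp only [star_sum, star_mul', star_star, star_parityExp, Matrix.conjTranspose_mul,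
    Matrix.conjTranspose_conjTranspose]
  rw [Finset.sum_comm]
  refine Finset.sum_congr rfl fun i _ => Finset.sum_congr rfl fun j _ => ?_
  rw [mul_comm (γ j), add_comm (k j : ℕ)]

/-- For each decrypted answer `a` the double sum is `g(a)† g(a)` with `g(a) = ∑ γ_i sgn(a)^{k_i}
W_i`. The same question has to be used in even and odd terms for this factorization. -/
theorem re_square_nonneg (n : ℕ) (x : X) {m : ℕ} (γ : Fin m → ℂ)
    (k : Fin m → Fin 2) (W : Fin m → Matrix (Bits (M.q n)) (Bits (M.q n)) ℂ) :
    0 ≤ (∑ i, ∑ j, star (γ i) * γ j *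
      M.expect n x (fun a => sgn a ^ (k i + k j : ℕ)) ((W i)ᴴ * W j)).re := by
  have h := expectLin_nonneg (M := M) n x
    (fun a => ∑ i, (γ i * sgn a ^ (k i : ℕ)) • W i)
  convert h using 2
  simp only [expect_eq_expectLin, ← smul_eq_mul (a := star _ * _), ← map_smul, ← map_sum]
  congr 1
  funext a
  simp only [Finset.sum_apply, Pi.smul_apply, Matrix.conjTranspose_sum, Finset.sum_mul,
    Finset.mul_sum, Matrix.conjTranspose_smul, Matrix.smul_mul, Matrix.mul_smul, smul_smul]
  rw [Finset.sum_comm]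
  refine Finset.sum_congr rfl fun j _ => Finset.sum_congr rfl fun i _ => ?_
  congr 1
  rw [star_mul', star_pow, star_sgn, pow_add]
  ring

theorem approx_positive [Fintype X] [DecidableEq X] [DecidableEq Y] (hS : S.Secure)
    (hM : M.IsProjective) (μ : PMF X) (x : X) {m : ℕ} (γ : Fin m → ℂ) (k : Fin m → Fin 2)
    (w : Fin m → List Y) {P : ObsPoly X Y}
    (hP : P = ∑ i, γ i • (ObsPoly.A x ^ (k i : ℕ) * ObsPoly.bobMonomial (w i))) :
    ∃ ε : ℕ → ℝ, Negligible ε ∧ ∀ n, (M.pseudoExp μ n (P.dagger * P)).im = 0 ∧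
      -ε n ≤ (M.pseudoExp μ n (P.dagger * P)).re := by
  -- One error function for each word `w_i† w_j`. There are finitely many, and the coefficients do
  -- not depend on `n`.
  choose ε hε h using fun i j : Fin m =>
    averageExp_indistinguishable hS hM μ ((w i).reverse ++ w j) x
  refine ⟨fun n => ∑ i, ∑ j, (‖γ i‖ * ‖γ j‖) * ε i j n,
    Negligible.sum _ fun i => Negligible.sum _ fun j => (hε i j).const_mul (by positivity),
    fun n => ?_⟩
  rw [pseudoExp_square hM μ n x γ k w hP]
  refine ⟨im_square_eq_zero μ n x γ k _, ?_⟩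
  have hpos := re_square_nonneg (M := M) n x γ k fun i => M.bobOp n (w i)
  set V := ∑ i, ∑ j, star (γ i) * γ j *
      M.parityExp μ n x (k i + k j) ((M.bobOp n (w i))ᴴ * M.bobOp n (w j)) with hV
  set N := ∑ i, ∑ j, star (γ i) * γ j *
      M.expect n x (fun a => sgn a ^ (k i + k j : ℕ)) ((M.bobOp n (w i))ᴴ * M.bobOp n (w j)) with hN
  have hVN : ‖V - N‖ ≤ ∑ i, ∑ j, (‖γ i‖ * ‖γ j‖) * ε i j n := by
    rw [hV, hN, ← Finset.sum_sub_distrib]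
    refine norm_sum_le_of_le _ fun i _ => ?_
    rw [← Finset.sum_sub_distrib]
    refine norm_sum_le_of_le _ fun j _ => ?_
    rw [← mul_sub, norm_mul, norm_mul, norm_star]
    gcongr
    have hh := h i j n
    have hT : M.bobOp n ((w i).reverse ++ w j) = (M.bobOp n (w i))ᴴ * M.bobOp n (w j) := by
      rw [bobOp_conjTranspose hM]; simp [bobOp]
    rw [hT] at hh
    -- Only even parity contributes to the difference; for odd parity the two values coincide, and
    -- `ε i j n ≥ 0` follows from its bounding a norm.
    simp only [parityExp, sgn_pow]
    split_ifs
    · exact hh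
    · rw [sub_self, norm_zero]
      exact (norm_nonneg _).trans hh
  have hre := (abs_le.mp ((Complex.abs_re_le_norm (V - N)).trans hVN)).1
  rw [Complex.sub_re] at hre
  linarith

/-! ### Bell functionals -/

/-- To be compared term by term with `prob_eq`: the only discrepancy is the coefficient of `sgn b`,
averaged here and taken at `x` there. -/
theorem pseudoExp_meas [Fintype X] [DecidableEq X] [DecidableEq Y] (hM : M.IsProjective)
    (μ : PMF X) (n : ℕ) (a b : Bool) (x : X) (y : Y) :
    M.pseudoExp μ n (ObsPoly.measA a x * ObsPoly.measB b y) =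
      1 / 4 * (1 + sgn a * M.expect n x sgn 1 + sgn b * M.averageExp μ n (M.bobObs n y) +
        sgn a * sgn b * M.expect n x sgn (M.bobObs n y)) := by
  have e : (ObsPoly.measA a x * ObsPoly.measB b y : ObsPoly X Y) = (1 / 4 : ℂ) •
      (MonoidAlgebra.single (obsWord x 0 []) 1 + sgn a • MonoidAlgebra.single (obsWord x 1 []) 1 +
        sgn b • MonoidAlgebra.single (obsWord x 0 [y]) 1 +
        (sgn a * sgn b) • MonoidAlgebra.single (obsWord x 1 [y]) 1) := by
    simp only [← ObsPoly.A_pow_mul_bobMonomial, ObsPoly.bobMonomial, ObsPoly.measA, ObsPoly.measB,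
      List.map_nil, List.prod_nil, List.map_cons, List.prod_cons, pow_zero, pow_one, one_mul,
      mul_one, mul_add, add_mul, smul_mul_assoc, mul_smul_comm, smul_add,
      smul_smul]
    ring_nf
    abel
  have hw : ∀ (m : ℕ) (v : List Y), M.pseudoExpMonomial μ n (obsWord x m v) =
      if Even m then M.averageExp μ n (M.bobOp n v) else M.expect n x sgn (M.bobOp n v) :=
    fun m v => pseudoExpMonomial_eq hM μ n (aliceLetters_obsWord x m v) (bobLetters_obsWord x m v)
  have h0 : M.bobOp n [] = 1 := rfl
  have h1 : M.bobOp n [y] = M.bobObs n y := by simp [bobOp]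
  simp only [e, map_smul, map_add, pseudoExp_single, hw, h0, h1, smul_eq_mul, one_mul]
  simp [averageExp_one]

theorem prob_eq (hM : M.IsProjective) (n : ℕ) (a b : Bool) (x : X) (y : Y) :
    (M.prob n a b x y : ℂ) =
      1 / 4 * (1 + sgn a * M.expect n x sgn 1 +
        sgn b * M.expect n x (fun _ => 1) (M.bobObs n y) +
        sgn a * sgn b * M.expect n x sgn (M.bobObs n y)) := by
  have hN : M.povm n y b = (1 / 2 : ℂ) • (1 + sgn b • M.bobObs n y) := by
    have h := M.povm_add n y
    cases b
    · simp only [← h, bobObs, sgn, Bool.false_eq_true, if_false]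
      module
    · simp only [← h, bobObs, sgn, if_true]
      module
  have hN' : (M.povm n y b)ᴴ = M.povm n y b := (hM n y b).isSelfAdjoint.star_eq
  -- Taking the real part loses nothing, since the expectation of a self-adjoint operator with a
  -- real weight is its own conjugate.
  have hre : (M.prob n a b x y : ℂ) =
      M.expect n x (fun a' => if a' = a then 1 else 0) (M.povm n y b) := by
    rw [prob, ← Complex.conj_eq_iff_re, ← Complex.star_def, expect_eq_expectLin, star_expectLin]
    congr 1
    funext a'
    rw [Matrix.conjTranspose_smul, hN']
    split_ifs <;> simp
  have e : (fun a' : Bool => (if a' = a then (1 : ℂ) else 0) • M.povm n y b) = (1 / 4 : ℂ) •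
      ((fun _ => (1 : ℂ) • (1 : Matrix (Bits (M.q n)) (Bits (M.q n)) ℂ)) +
        sgn a • (fun a' => sgn a' • (1 : Matrix (Bits (M.q n)) (Bits (M.q n)) ℂ)) +
        sgn b • (fun _ => (1 : ℂ) • M.bobObs n y) +
        (sgn a * sgn b) • fun a' => sgn a' • M.bobObs n y) := by
    funext a'
    simp only [Pi.smul_apply, Pi.add_apply, hN]
    cases a <;> cases a' <;>
      simp only [sgn, if_true, if_false, Bool.false_eq_true, Bool.true_eq_false] <;> module
  have h1 := expect_one M n x
  rw [expect_eq_expectLin] at h1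
  simp only [hre, expect_eq_expectLin, e, map_smul, map_add, smul_eq_mul, h1]

/-- After cancellation only Bob's marginals remain. Both claims on Bell functionals follow: each
difference is negligible, and suitably weighted differences cancel. -/
theorem pseudoExp_bellOperator_sub [Fintype X] [DecidableEq X] [Fintype Y] [DecidableEq Y]
    (hM : M.IsProjective) (μ : PMF X) (n : ℕ) (w : Bool → Bool → X → Y → ℝ) :
    M.pseudoExp μ n (ObsPoly.bellOperator w) - (M.bellValue n w : ℂ) =
      ∑ x, ∑ y, 1 / 4 * ((∑ a, (w a false x y - w a true x y) : ℝ) : ℂ) *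
        (M.averageExp μ n (M.bobObs n y) - M.expect n x (fun _ => 1) (M.bobObs n y)) := by
  simp only [ObsPoly.bellOperator, bellValue, map_sum, map_add, map_smul, Complex.ofReal_sum,
    Complex.ofReal_add,
    Complex.ofReal_mul, pseudoExp_meas hM, prob_eq hM, smul_eq_mul, Fintype.sum_bool,
    ← Finset.sum_sub_distrib, ← Finset.sum_add_distrib]
  refine Finset.sum_congr rfl fun x _ => Finset.sum_congr rfl fun y _ => ?_
  simp only [sgn, if_true, Bool.false_eq_true, if_false]
  push_cast
  ring

theorem bell_approx [Fintype X] [DecidableEq X] [Fintype Y] [DecidableEq Y] (hS : S.Secure)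
    (hM : M.IsProjective) (μ : PMF X) (w : Bool → Bool → X → Y → ℝ) :
    ∃ ε : ℕ → ℝ, Negligible ε ∧ ∀ n,
      ‖M.pseudoExp μ n (ObsPoly.bellOperator w) - (M.bellValue n w : ℂ)‖ ≤ ε n := by
  choose ε hε h using fun (x : X) (y : Y) => averageExp_indistinguishable hS hM μ [y] x
  refine ⟨fun n => ∑ x, ∑ y,
      ‖(1 / 4 * ((∑ a, (w a false x y - w a true x y) : ℝ) : ℂ))‖ * ε x y n,
    Negligible.sum _ fun x => Negligible.sum _ fun y => (hε x y).const_mul (norm_nonneg _),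
    fun n => ?_⟩
  rw [pseudoExp_bellOperator_sub hM]
  refine norm_sum_le_of_le _ fun x _ => norm_sum_le_of_le _ fun y _ => ?_
  rw [norm_mul]
  gcongr
  have h1 : M.bobOp n [y] = M.bobObs n y := by simp [bobOp]
  rw [← h1]
  exact h x y n

/-- For fixed `y` the deviations from a `μ`-average, weighted by `μ`, sum to zero; neither security
nor an estimate is involved. -/
theorem bell_exact [Fintype X] [DecidableEq X] [Fintype Y] [DecidableEq Y]
    (hM : M.IsProjective) (μ : PMF X) (w : Bool → Bool → X → Y → ℝ) (β : Y → ℝ)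
    (hw : ∀ x y, ∑ a, ((w a false x y) - (w a true x y)) = (μ x).toReal * β y) (n : ℕ) :
    M.pseudoExp μ n (ObsPoly.bellOperator w) = (M.bellValue n w : ℂ) := by
  rw [← sub_eq_zero, pseudoExp_bellOperator_sub hM, Finset.sum_comm]
  refine Finset.sum_eq_zero fun y _ => ?_
  have h : ∀ x, 1 / 4 * ((∑ a, (w a false x y - w a true x y) : ℝ) : ℂ) *
        (M.averageExp μ n (M.bobObs n y) - M.expect n x (fun _ => 1) (M.bobObs n y)) =
      1 / 4 * β y * (((μ x).toReal : ℂ) * M.averageExp μ n (M.bobObs n y) -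
        ((μ x).toReal : ℂ) * M.expect n x (fun _ => 1) (M.bobObs n y)) := by
    intro x
    rw [hw]
    push_cast
    ring
  rw [Finset.sum_congr rfl fun x _ => h x]
  simp only [← Finset.mul_sum, Finset.sum_sub_distrib, ← Finset.sum_mul, sum_pmf_complex,
    one_mul]
  rw [averageExp, sub_self, mul_zero]

end CompiledModel

end

theorem mainTheorem1 {X Y : Type} [Fintype X] [DecidableEq X] [Fintype Y] [DecidableEq Y]
    (S : EncScheme X) (hS : S.Secure) (M : CompiledModel S Y) (hM : M.IsProjective)
    (μ : PMF X) :
    -- approximate positivity on Hermitian squares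
    (∀ (x : X) (m : ℕ) (γ : Fin m → ℂ) (k : Fin m → Fin 2) (w : Fin m → List Y)
        (P : ObsPoly X Y),
        P = ∑ i, γ i • (ObsPoly.A x ^ (k i : ℕ) * ObsPoly.bobMonomial (w i)) →
        ∃ ε : ℕ → ℝ, Negligible ε ∧ ∀ n,
          (M.pseudoExp μ n (P.dagger * P)).im = 0 ∧
          -ε n ≤ (M.pseudoExp μ n (P.dagger * P)).re) ∧
    -- Bell functionals, up to a negligible function
    (∀ w : Bool → Bool → X → Y → ℝ, ∃ ε : ℕ → ℝ, Negligible ε ∧ ∀ n,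
        ‖M.pseudoExp μ n (ObsPoly.bellOperator w) - (M.bellValue n w : ℂ)‖ ≤ ε n) ∧
    -- exact equality if the marginal terms of Bob are weighted according to `μ`
    (∀ (w : Bool → Bool → X → Y → ℝ) (β : Y → ℝ),
        (∀ x y, ∑ a, ((w a false x y) - (w a true x y)) = (μ x).toReal * β y) →
        ∀ n, M.pseudoExp μ n (ObsPoly.bellOperator w) = (M.bellValue n w : ℂ)) := by
  exact ⟨fun x _ γ k w _ hP => CompiledModel.approx_positive hS hM μ x γ k w hP,
    CompiledModel.bell_approx hS hM μ, CompiledModel.bell_exact hM μ⟩
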